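/- All vector spaces are over $\mathbb C$; modules over Lie superalgebras are $\mathbb Z/2$-graded, simple means nonzero without proper nonzero graded submodules, and $\cong$ denotes even isomorphism. Let $\mathcal S(\frac12)$ be the Lie superalgebra with basis $\{L_m,\psi_r,c,z : m\in\mathbb Z,\ r\in\mathbb Z+\frac12\}$, where $L_m,c,z$ are even, $\psi_r$ is odd, $c,z$ are central, and $$[L_m,L_n]=(m-n)L_{m+n}+\delta_{m,-n}\tfrac{m^3-m}{12}c,\qquad [L_m,\psi_r]=(-r-\tfrac m2)\psi_{m+r},\qquad [\psi_r,\psi_s]=\delta_{r,-s}z .$$ Let $\mathrm{Vir}=\mathrm{span}\{c,L_m : m\in\mathbb Z\}$. A module over $\mathcal S(\frac12)$ (resp. $\mathrm{Vir}$) is smooth if each of its vectors is annihilated by $L_i$ and $\psi_r$ (resp. by $L_i$) for all sufficiently large $i$ and $r$; an $\mathcal S(\frac12)$-module has level $\lambda$ if $z$ acts on it as the scalar $\lambda$. Let $\mathscr V(\frac12)$ be the exterior algebra on odd generators $\xi_r$, $r\in\mathbb Z_{\ge0}+\frac12$, graded by the parity of the degree. It is an $\mathcal S(\frac12)$-module on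 which, for $r>0$, $\psi_r$ acts as $\partial/\partial\xi_r$ and $\psi_{-r}$ as multiplication by $\xi_r$, while $z$ acts as $1$, $c$ as $\frac12$, and $L_k$ as $\frac12\sum_{r\in\mathbb Z+\frac12} r:\!\psi_{-r}\psi_{r+k}\!:$, where $:\!\psi_r\psi_s\!:$ equals $\psi_r\psi_s$ if $s\ge r$ and $-\psi_s\psi_r$ if $s<r$. For $\mu\in\mathbb C^*$ let $\mathscr V(\frac12)^{\mu}$ be this module twisted by the automorphism $L_k\mapsto L_k$, $\psi_r\mapsto\mu\psi_r$, $c\mapsto c$, $z\mapsto\mu^2z$. For a $\mathrm{Vir}$-module $V$, placed in one of the two parities, let $V^{\mathcal S(\frac12)}$ be the $\mathcal S(\frac12)$-module obtained by letting all $\psi_r$ and $z$ act by zero. **Theorem.** Let $M$ be a simple smooth $\mathcal S(\frac12)$-module of level $\lambda\in\mathbb C^*$. Then $$M\cong\mathscr V(\tfrac12)^{\sqrt\lambda}\otimes V^{\mathcal S(\frac12)}$$ for some simple smooth $\mathrm{Vir}$-module $V$, placed in even or in odd parity, and some $\sqrt\lambda\in\mathbb C$ with $(\sqrt\lambda)^2=\lambda$.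 -/

import Mathlib

open scoped TensorProduct

universe u

noncomputable section

/-! ## Lie superalgebras over `ℂ` and their modules -/

/-- The sign `(-1)^{ab}` attached to two parities `a, b ∈ ℤ/2`. -/
def koszul (a b : ZMod 2) : ℂ := if a = 1 ∧ b = 1 then -1 else 1

/-- A Lie superalgebra over `ℂ`: a `ℤ/2`-graded vector space `𝔤 = 𝔤₀ ⊕ 𝔤₁` with a bilinear even
bracket which is super-skew-symmetric and satisfies the super Jacobi identity. -/
class LieSuperalgebra (𝔤 : Type*) [AddCommGroup 𝔤] [Module ℂ 𝔤] where
  part : ZMod 2 → Submodule ℂ 𝔤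
  isCompl : IsCompl (part 0) (part 1)
  bracket : 𝔤 →ₗ[ℂ] 𝔤 →ₗ[ℂ] 𝔤
  bracket_mem : ∀ {a b : ZMod 2} {x y : 𝔤}, x ∈ part a → y ∈ part b → bracket x y ∈ part (a + b)
  bracket_skew : ∀ {a b : ZMod 2} {x y : 𝔤}, x ∈ part a → y ∈ part b →
    bracket x y = -(koszul a b • bracket y x)
  jacobi : ∀ {a b d : ZMod 2} {x y w : 𝔤}, x ∈ part a → y ∈ part b → w ∈ part d →
    bracket x (bracket y w) = bracket (bracket x y) w + koszul a b • bracket y (bracket x w)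

/-- The data of an action of `𝔤` on a `ℤ/2`-graded vector space `M = M₀ ⊕ M₁`: a linear map from
`𝔤` to the endomorphisms of `M`. It is a module over the Lie superalgebra when
`SuperAction.IsModule` holds. -/
structure SuperAction (𝔤 : Type*) [AddCommGroup 𝔤] [Module ℂ 𝔤]
    (M : Type*) [AddCommGroup M] [Module ℂ M] where
  part : ZMod 2 → Submodule ℂ M
  isCompl : IsCompl (part 0) (part 1)
  act : 𝔤 →ₗ[ℂ] Module.End ℂ M

namespace SuperAction

variable {𝔤 : Type*} [AddCommGroup 𝔤] [Module ℂ 𝔤]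
variable {M : Type*} [AddCommGroup M] [Module ℂ M] {N : Type*} [AddCommGroup N] [Module ℂ N]

/-- The module axioms: `𝔤_a M_b ⊆ M_{a+b}`, and `[x, y] v = x y v - (-1)^{ab} y x v` for
`x ∈ 𝔤_a`, `y ∈ 𝔤_b`. -/
structure IsModule [LieSuperalgebra 𝔤] (A : SuperAction 𝔤 M) : Prop where
  act_mem : ∀ {a b : ZMod 2} {x : 𝔤} {v : M}, x ∈ LieSuperalgebra.part a → v ∈ A.part b →
    A.act x v ∈ A.part (a + b)
  act_bracket : ∀ {a b : ZMod 2} {x y : 𝔤},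
    x ∈ LieSuperalgebra.part a → y ∈ LieSuperalgebra.part b → ∀ v : M,
    A.act (LieSuperalgebra.bracket x y) v
      = A.act x (A.act y v) - koszul a b • A.act y (A.act x v)

/-- Simplicity: `M ≠ 0`, and the only graded submodules of `M` are `0` and `M`. -/
def IsSimple (A : SuperAction 𝔤 M) : Prop :=
  Nontrivial M ∧ ∀ W : Submodule ℂ M,
    (∀ (x : 𝔤), ∀ w ∈ W, A.act x w ∈ W) → W = (W ⊓ A.part 0) ⊔ (W ⊓ A.part 1) →
      W = ⊥ ∨ W = ⊤

/-- The parity operator of `M`: the identity on `M₀`, minus the identity on `M₁`. -/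
def parityOp (A : SuperAction 𝔤 M) : Module.End ℂ M :=
  (A.part 0).projection (A.part 1) A.isCompl - (A.part 1).projection (A.part 0) A.isCompl.symm

/-- Isomorphisms: even linear bijections that intertwine the actions. -/
structure Iso (A : SuperAction 𝔤 M) (B : SuperAction 𝔤 N) where
  toEquiv : M ≃ₗ[ℂ] N
  map_mem : ∀ (a : ZMod 2), ∀ v ∈ A.part a, toEquiv v ∈ B.part a
  map_act : ∀ (x : 𝔤) (v : M), toEquiv (A.act x v) = B.act x (toEquiv v)

/-- The `a`-part of `M ⊗ N`, namely `(M₀ ⊗ N_a) + (M₁ ⊗ N_{a+1})`. -/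
def tensorPart (A : SuperAction 𝔤 M) (B : SuperAction 𝔤 N) (a : ZMod 2) :
    Submodule ℂ (M ⊗[ℂ] N) :=
  Submodule.map₂ (TensorProduct.mk ℂ M N) (A.part 0) (B.part a) ⊔
    Submodule.map₂ (TensorProduct.mk ℂ M N) (A.part 1) (B.part (a + 1))

theorem parityOp_apply_zero (A : SuperAction 𝔤 M) {v : M} (hv : v ∈ A.part 0) :
    A.parityOp v = v := by
  simp [parityOp, Submodule.projection_apply_of_mem_left _ hv,
    Submodule.projection_apply_of_mem_right _ hv]

theorem parityOp_apply_one (A : SuperAction 𝔤 M) {v : M} (hv : v ∈ A.part 1) :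
    A.parityOp v = -v := by
  simp [parityOp, Submodule.projection_apply_of_mem_left _ hv,
    Submodule.projection_apply_of_mem_right _ hv]

theorem isCompl_tensorPart (A : SuperAction 𝔤 M) (B : SuperAction 𝔤 N) :
    IsCompl (A.tensorPart B 0) (A.tensorPart B 1) := by
  have h11 : (1 : ZMod 2) + 1 = 0 := by decide
  constructor
  · rw [Submodule.disjoint_def]
    intro x h0 h1
    have e0 : A.tensorPart B 0 ≤
        LinearMap.ker (TensorProduct.map A.parityOp B.parityOp - LinearMap.id) := by
      refine sup_le (Submodule.map₂_le.2 ?_) (Submodule.map₂_le.2 ?_)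
      · intro m hm n hn
        simp [parityOp_apply_zero _ hm, parityOp_apply_zero _ hn]
      · intro m hm n hn
        rw [zero_add] at hn
        simp [parityOp_apply_one _ hm, parityOp_apply_one _ hn, TensorProduct.neg_tmul,
          TensorProduct.tmul_neg]
    have e1 : A.tensorPart B 1 ≤
        LinearMap.ker (TensorProduct.map A.parityOp B.parityOp + LinearMap.id) := by
      refine sup_le (Submodule.map₂_le.2 ?_) (Submodule.map₂_le.2 ?_)
      · intro m hm n hn
        simp [parityOp_apply_zero _ hm, parityOp_apply_one _ hn, TensorProduct.tmul_neg]
      · intro m hm n hn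
        rw [h11] at hn
        simp [parityOp_apply_one _ hm, parityOp_apply_zero _ hn, TensorProduct.neg_tmul]
    have f0 := e0 h0
    have f1 := e1 h1
    simp only [LinearMap.mem_ker, LinearMap.sub_apply, LinearMap.add_apply,
      LinearMap.id_apply] at f0 f1
    have h2 : (2 : ℂ) • x = 0 := by
      rw [two_smul]
      calc x + x = (TensorProduct.map A.parityOp B.parityOp x + x)
            - (TensorProduct.map A.parityOp B.parityOp x - x) := by abel
        _ = 0 := by rw [f0, f1, sub_zero]
    exact (smul_eq_zero.1 h2).resolve_left two_ne_zero
  · rw [codisjoint_iff, eq_top_iff, ← TensorProduct.map₂_mk_top_top_eq_top,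
      ← A.isCompl.sup_eq_top, ← B.isCompl.sup_eq_top, Submodule.map₂_sup_left,
      Submodule.map₂_sup_right, Submodule.map₂_sup_right]
    simp only [tensorPart, zero_add, h11]
    refine sup_le (sup_le ?_ ?_) (sup_le ?_ ?_)
    · exact le_sup_of_le_left le_sup_left
    · exact le_sup_of_le_right le_sup_left
    · exact le_sup_of_le_right le_sup_right
    · exact le_sup_of_le_left le_sup_right

/-- The tensor product of two modules: `x (v ⊗ w) = x v ⊗ w + (-1)^{|x||v|} v ⊗ x w` for
homogeneous `x` and `v`. Here `x = x₀ + x₁` is split into its even and odd component, and the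
sign for the odd component is the parity operator of `M`. -/
def tensor [LieSuperalgebra 𝔤] (A : SuperAction 𝔤 M) (B : SuperAction 𝔤 N) :
    SuperAction 𝔤 (M ⊗[ℂ] N) where
  part := A.tensorPart B
  isCompl := A.isCompl_tensorPart B
  act :=
    (TensorProduct.mapBilinear (RingHom.id ℂ) M N M N).flip LinearMap.id ∘ₗ A.act
    + TensorProduct.mapBilinear (RingHom.id ℂ) M N M N LinearMap.id ∘ₗ B.act ∘ₗ
        (LieSuperalgebra.part 0).projection (LieSuperalgebra.part 1) LieSuperalgebra.isCompl
    + TensorProduct.mapBilinear (RingHom.id ℂ) M N M N A.parityOp ∘ₗ B.act ∘ₗ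
        (LieSuperalgebra.part 1).projection (LieSuperalgebra.part 0) LieSuperalgebra.isCompl.symm

end SuperAction

/-! ## The Virasoro algebra -/

/-- The basis `{L_m, c}` of the Virasoro algebra. -/
inductive VirGen : Type
  | L (m : ℤ)
  | c

/-- The Virasoro algebra, with basis `VirGen`. -/
def Vir : Type := VirGen →₀ ℂ

namespace Vir

instance : AddCommGroup Vir := inferInstanceAs (AddCommGroup (VirGen →₀ ℂ))
instance : Module ℂ Vir := inferInstanceAs (Module ℂ (VirGen →₀ ℂ))

/-- The basis vectors. -/
def basis (g : VirGen) : Vir := Finsupp.single g 1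

/-- The linear map with prescribed values on the basis. -/
def lift {M : Type*} [AddCommGroup M] [Module ℂ M] (f : VirGen → M) : Vir →ₗ[ℂ] M :=
  Finsupp.linearCombination ℂ f

@[simp] theorem lift_basis {M : Type*} [AddCommGroup M] [Module ℂ M] (f : VirGen → M)
    (g : VirGen) : lift f (basis g) = f g :=
  (Finsupp.linearCombination_single ℂ (1 : ℂ) g).trans (one_smul ℂ (f g))

/-- `[L_m, L_n] = (m - n) L_{m+n} + δ_{m,-n} (m³ - m)/12 c`, and `c` is central. -/
def bracketGen : VirGen → VirGen → Vir
  | .L m, .L n => ((m : ℂ) - n) • basis (.L (m + n)) +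
      (if m + n = 0 then ((m : ℂ) ^ 3 - m) / 12 else 0) • basis .c
  | _, _ => 0

/-- The bracket of the Virasoro algebra. -/
def bracket : Vir →ₗ[ℂ] Vir →ₗ[ℂ] Vir := lift fun g => lift (bracketGen g)

theorem bracket_L_L (m n : ℤ) : bracket (basis (.L m)) (basis (.L n)) =
    ((m : ℂ) - n) • basis (.L (m + n)) +
      (if m + n = 0 then ((m : ℂ) ^ 3 - m) / 12 else 0) • basis .c := by
  simp [bracket, bracketGen]

theorem bracket_c_left (g : VirGen) : bracket (basis .c) (basis g) = 0 := by
  simp [bracket, bracketGen]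

theorem bracket_c_right (g : VirGen) : bracket (basis g) (basis .c) = 0 := by
  rcases g with _ | _ <;> simp [bracket, bracketGen]

theorem induct {p : Vir → Prop} (x : Vir) (h0 : p 0) (hadd : ∀ x y, p x → p y → p (x + y))
    (hs : ∀ (r : ℂ) g, p (r • basis g)) : p x := by
  refine Finsupp.induction_linear (motive := p) x h0 hadd ?_
  intro g r
  have : (Finsupp.single g r : VirGen →₀ ℂ) = r • (Finsupp.single g 1 : VirGen →₀ ℂ) := by simp
  rw [this]
  exact hs r g

theorem bracket_skew (x y : Vir) : bracket x y = -bracket y x := by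
  induction x using induct with
  | h0 => simp
  | hadd x x' hx hx' => simp [hx, hx']; abel
  | hs r g =>
    induction y using induct with
    | h0 => simp
    | hadd y y' hy hy' => rw [map_add, hy, hy', map_add, LinearMap.add_apply]; abel
    | hs s g' =>
      simp only [map_smul, LinearMap.smul_apply, bracket, lift_basis]
      rw [smul_comm, ← smul_neg, ← smul_neg]
      congr 2
      rcases g with m | _ <;> rcases g' with n | _ <;> simp only [bracketGen, neg_zero]
      rw [add_comm n m]
      by_cases h : m + n = 0
      · obtain rfl : n = -m := by omega
        simp only [h, if_true]
        push_cast
        module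
      · simp only [h, if_false]
        module

theorem jacobi (x y w : Vir) :
    bracket x (bracket y w) = bracket (bracket x y) w + bracket y (bracket x w) := by
  induction x using induct with
  | h0 => simp
  | hadd x x' hx hx' => simp only [map_add, LinearMap.add_apply, hx, hx']; abel
  | hs r g =>
  induction y using induct with
  | h0 => simp
  | hadd y y' hy hy' => simp only [map_add, LinearMap.add_apply, hy, hy']; abel
  | hs s g' =>
  induction w using induct with
  | h0 => simp
  | hadd w w' hw hw' => simp only [map_add, hw, hw']; abel
  | hs t g'' =>
  have key : bracket (basis g) (bracket (basis g') (basis g''))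
      = bracket (bracket (basis g) (basis g')) (basis g'')
        + bracket (basis g') (bracket (basis g) (basis g'')) := by
    rcases g with m | _ <;> rcases g' with n | _ <;> rcases g'' with k | _ <;>
      simp only [bracket_L_L, bracket_c_left, bracket_c_right, map_add, map_smul, map_zero,
        LinearMap.add_apply, LinearMap.smul_apply, LinearMap.zero_apply, add_zero, smul_zero]
    rw [show n + (m + k) = m + (n + k) by ring, show m + n + k = m + (n + k) by ring]
    by_cases h : m + (n + k) = 0
    · obtain rfl : k = -m - n := by omega
      simp only [h, if_true]
      push_cast
      module
    · simp only [h, if_false]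
      push_cast
      module
  simp only [map_smul, LinearMap.smul_apply, key, smul_add]
  simp only [smul_smul]
  congr 2 <;> ring

instance : LieRing Vir where
  bracket x y := bracket x y
  add_lie x y w := by simp
  lie_add x y w := by simp
  lie_self x := by
    have h : bracket x x = -bracket x x := bracket_skew x x
    have h2 : (2 : ℂ) • bracket x x = 0 := by
      rw [two_smul]
      nth_rewrite 1 [h]
      exact neg_add_cancel _
    exact (smul_eq_zero.1 h2).resolve_left two_ne_zero
  leibniz_lie x y w := jacobi x y w

instance : LieAlgebra ℂ Vir where
  lie_smul r x y := (bracket x).map_smul r y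

/-- A module over the Virasoro algebra is smooth if each of its vectors is annihilated by `L_i`
for all sufficiently large `i`. -/
def IsSmooth (V : Type*) [AddCommGroup V] [LieRingModule Vir V] : Prop :=
  ∀ v : V, ∃ n : ℕ, ∀ i : ℤ, (n : ℤ) < i → ⁅basis (.L i), v⁆ = 0

end Vir

/-! ## The Fermion-Virasoro algebra `𝒮(1/2)` -/

/-- The basis `{L_m, ψ_r, c, z : m ∈ ℤ, r ∈ ℤ + 1/2}` of `𝒮(1/2)`; the constructor `psi k` stands
for `ψ_{k + 1/2}`. -/
inductive FVGen : Type
  | L (m : ℤ)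
  | psi (k : ℤ)
  | c
  | z

/-- The `ψ_r` are odd, the other basis vectors are even. -/
def FVGen.parity : FVGen → ZMod 2
  | .psi _ => 1
  | _ => 0

/-- The Fermion-Virasoro algebra `𝒮(1/2)`, with basis `FVGen`. -/
def FV : Type := FVGen →₀ ℂ

namespace FV

instance : AddCommGroup FV := inferInstanceAs (AddCommGroup (FVGen →₀ ℂ))
instance : Module ℂ FV := inferInstanceAs (Module ℂ (FVGen →₀ ℂ))

/-- The basis vectors. -/
def basis (g : FVGen) : FV := Finsupp.single g 1

/-- The linear map with prescribed values on the basis. -/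
def lift {M : Type*} [AddCommGroup M] [Module ℂ M] (f : FVGen → M) : FV →ₗ[ℂ] M :=
  Finsupp.linearCombination ℂ f

@[simp] theorem lift_basis {M : Type*} [AddCommGroup M] [Module ℂ M] (f : FVGen → M)
    (g : FVGen) : lift f (basis g) = f g :=
  (Finsupp.linearCombination_single ℂ (1 : ℂ) g).trans (one_smul ℂ (f g))

/-- `[L_m, L_n] = (m - n) L_{m+n} + δ_{m,-n} (m³ - m)/12 c`, `[L_m, ψ_r] = (-r - m/2) ψ_{m+r}`,
`[ψ_r, ψ_s] = δ_{r,-s} z`, and `c`, `z` are central. With `r = j + 1/2` and `s = k + 1/2` the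
condition `r = -s` reads `j + k + 1 = 0`. -/
def bracketGen : FVGen → FVGen → FV
  | .L m, .L n => ((m : ℂ) - n) • basis (.L (m + n)) +
      (if m + n = 0 then ((m : ℂ) ^ 3 - m) / 12 else 0) • basis .c
  | .L m, .psi k => (-((k : ℂ) + 1 / 2) - (m : ℂ) / 2) • basis (.psi (m + k))
  | .psi k, .L m => (((k : ℂ) + 1 / 2) + (m : ℂ) / 2) • basis (.psi (m + k))
  | .psi j, .psi k => (if j + k + 1 = 0 then (1 : ℂ) else 0) • basis .z
  | _, _ => 0

/-- The bracket of `𝒮(1/2)`. -/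
def bracket : FV →ₗ[ℂ] FV →ₗ[ℂ] FV := lift fun g => lift (bracketGen g)

/-- The span of the basis vectors of parity `a`. -/
def part (a : ZMod 2) : Submodule ℂ FV := Submodule.span ℂ (basis '' {g | g.parity = a})

@[simp] theorem bracket_basis (g g' : FVGen) : bracket (basis g) (basis g') = bracketGen g g' := by
  simp [bracket]

theorem basis_mem_part (g : FVGen) : basis g ∈ part g.parity :=
  Submodule.subset_span ⟨g, rfl, rfl⟩

theorem basis_mem_part' {g : FVGen} {a : ZMod 2} (h : g.parity = a) : basis g ∈ part a :=
  h ▸ basis_mem_part g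

theorem span_basis : Submodule.span ℂ (Set.range basis) = ⊤ :=
  (Finsupp.basisSingleOne (R := ℂ) (ι := FVGen)).span_eq ▸ (by
    congr 1)

theorem linearIndependent_basis : LinearIndependent ℂ basis :=
  Finsupp.linearIndependent_single_one ℂ FVGen

theorem isCompl_part : IsCompl (part 0) (part 1) := by
  constructor
  · refine linearIndependent_basis.disjoint_span_image ?_
    rw [Set.disjoint_left]
    rintro g (hg : g.parity = 0) (hg' : g.parity = 1)
    rw [hg] at hg'
    exact absurd hg' (by decide)
  · rw [codisjoint_iff, eq_top_iff, ← span_basis, Submodule.span_le]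
    rintro _ ⟨g, rfl⟩
    rcases g with _ | _ | _ | _
    · exact Submodule.mem_sup_left (basis_mem_part' rfl)
    · exact Submodule.mem_sup_right (basis_mem_part' rfl)
    · exact Submodule.mem_sup_left (basis_mem_part' rfl)
    · exact Submodule.mem_sup_left (basis_mem_part' rfl)

theorem part_induct {a : ZMod 2} {p : FV → Prop} {x : FV} (hx : x ∈ part a)
    (h0 : p 0) (hadd : ∀ x y, p x → p y → p (x + y)) (hsmul : ∀ (r : ℂ) x, p x → p (r • x))
    (hs : ∀ g : FVGen, g.parity = a → p (basis g)) : p x := by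
  refine Submodule.span_induction (p := fun x _ => p x) ?_ h0 (fun x y _ _ => hadd x y)
    (fun r x _ => hsmul r x) hx
  rintro _ ⟨g, hg, rfl⟩
  exact hs g hg

theorem bracket_mem {a b : ZMod 2} {x y : FV} (hx : x ∈ part a) (hy : y ∈ part b) :
    bracket x y ∈ part (a + b) := by
  refine part_induct (p := fun x => bracket x y ∈ part (a + b)) hx
    (by simp) (fun x x' h h' => ?_) (fun r x h => ?_) (fun g hg => ?_)
  · rw [map_add, LinearMap.add_apply]
    exact add_mem h h'
  · rw [map_smul, LinearMap.smul_apply]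
    exact Submodule.smul_mem _ _ h
  refine part_induct (p := fun y => bracket (basis g) y ∈ part (a + b)) hy
    (by simp) (fun y y' h h' => ?_) (fun r y h => ?_) (fun g' hg' => ?_)
  · rw [map_add]
    exact add_mem h h'
  · rw [map_smul]
    exact Submodule.smul_mem _ _ h
  subst hg hg'
  rw [bracket_basis]
  rcases g with m | j | _ | _ <;> rcases g' with n | k | _ | _ <;>
    simp only [bracketGen, Submodule.zero_mem]
  · exact add_mem (Submodule.smul_mem _ _ (basis_mem_part' rfl))
      (Submodule.smul_mem _ _ (basis_mem_part' rfl))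
  · exact Submodule.smul_mem _ _ (basis_mem_part' rfl)
  · exact Submodule.smul_mem _ _ (basis_mem_part' rfl)
  · exact Submodule.smul_mem _ _ (basis_mem_part' (show (0 : ZMod 2) = 1 + 1 by decide))

theorem bracketGen_skew (g g' : FVGen) :
    bracketGen g g' = -(koszul g.parity g'.parity • bracketGen g' g) := by
  rcases g with m | j | _ | _ <;> rcases g' with n | k | _ | _ <;>
    simp only [bracketGen, smul_zero, neg_zero]
  · rw [add_comm n m]
    by_cases h : m + n = 0
    · obtain rfl : n = -m := by omega
      simp only [h, if_true, koszul, FVGen.parity]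
      push_cast
      simp only [zero_ne_one, and_self, if_false]
      module
    · simp only [h, if_false, koszul, FVGen.parity, zero_ne_one, and_self]
      module
  · simp only [koszul, FVGen.parity, zero_ne_one, false_and, and_false, if_false]
    module
  · simp only [koszul, FVGen.parity, zero_ne_one, false_and, and_false, if_false]
    module
  · rw [add_comm k j]
    simp only [koszul, FVGen.parity, and_self, if_true]
    module

theorem bracket_skew {a b : ZMod 2} {x y : FV} (hx : x ∈ part a) (hy : y ∈ part b) :
    bracket x y = -(koszul a b • bracket y x) := by
  refine part_induct (p := fun x => bracket x y = -(koszul a b • bracket y x)) hx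
    (by simp) (fun x x' h h' => ?_) (fun r x h => ?_) (fun g hg => ?_)
  · simp only [map_add, LinearMap.add_apply, h, h', smul_add, neg_add]
  · simp only [map_smul, LinearMap.smul_apply, h]
    rw [smul_comm, smul_neg]
  refine part_induct
    (p := fun y => bracket (basis g) y = -(koszul a b • bracket y (basis g))) hy
    (by simp) (fun y y' h h' => ?_) (fun r y h => ?_) (fun g' hg' => ?_)
  · simp only [map_add, LinearMap.add_apply, h, h', smul_add, neg_add]
  · simp only [map_smul, LinearMap.smul_apply, h]
    rw [smul_comm _ r, smul_neg]
  subst hg hg'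
  rw [bracket_basis, bracket_basis]
  exact bracketGen_skew g g'

theorem jacobiGen (g g' g'' : FVGen) :
    bracket (basis g) (bracketGen g' g'') = bracket (bracketGen g g') (basis g'')
      + koszul g.parity g'.parity • bracket (basis g') (bracketGen g g'') := by
  rcases g with m | i | _ | _ <;> rcases g' with n | j | _ | _ <;> rcases g'' with p | k | _ | _ <;>
    simp only [bracketGen, bracket_basis, map_add, map_smul, map_zero, LinearMap.add_apply,
      LinearMap.smul_apply, LinearMap.zero_apply, add_zero, smul_zero, zero_add, koszul,
      FVGen.parity, zero_ne_one, false_and, and_false, if_false, and_self, if_true, one_smul]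
  -- the triples `LLL`, `LLψ`, `LψL`, `Lψψ`, `ψLL`, `ψLψ`, `ψψL` remain
  · rw [show n + (m + p) = m + (n + p) by ring, show m + n + p = m + (n + p) by ring]
    by_cases h : m + (n + p) = 0
    · obtain rfl : p = -m - n := by omega
      simp only [h, if_true]
      push_cast
      module
    · simp only [h, if_false]
      push_cast
      module
  · rw [show n + (m + k) = m + (n + k) by ring, show m + n + k = m + (n + k) by ring]
    push_cast
    module
  · rw [show p + (m + j) = m + (p + j) by ring, show m + p + j = m + (p + j) by ring]
    push_cast
    module
  · rw [show j + (m + k) = m + j + k by ring]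
    by_cases h : m + j + k + 1 = 0
    · obtain rfl : m = -j - k - 1 := by omega
      simp only [h, if_true]
      push_cast
      module
    · simp only [h, if_false, zero_smul, smul_zero, add_zero]
  · rw [show p + (n + i) = n + p + i by ring, show n + (p + i) = n + p + i by ring]
    push_cast
    module
  · rw [show i + (n + k) = n + i + k by ring]
    by_cases h : n + i + k + 1 = 0
    · obtain rfl : n = -i - k - 1 := by omega
      simp only [h, if_true]
      push_cast
      module
    · simp only [h, if_false, zero_smul, smul_zero]
  · rw [show j + (p + i) = i + (p + j) by ring]
    by_cases h : i + (p + j) + 1 = 0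
    · obtain rfl : p = -i - j - 1 := by omega
      simp only [h, if_true]
      push_cast
      module
    · simp only [h, if_false, zero_smul, smul_zero]

theorem jacobi {a b d : ZMod 2} {x y w : FV} (hx : x ∈ part a) (hy : y ∈ part b)
    (hw : w ∈ part d) :
    bracket x (bracket y w) = bracket (bracket x y) w + koszul a b • bracket y (bracket x w) := by
  refine part_induct (p := fun x => bracket x (bracket y w) =
      bracket (bracket x y) w + koszul a b • bracket y (bracket x w)) hx
    (by simp) (fun x x' h h' => ?_) (fun r x h => ?_) (fun g hg => ?_)
  · simp only [map_add, LinearMap.add_apply, h, h', smul_add]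
    abel
  · simp only [map_smul, LinearMap.smul_apply, h, smul_add]
    rw [smul_comm r]
  refine part_induct (p := fun y => bracket (basis g) (bracket y w) =
      bracket (bracket (basis g) y) w + koszul a b • bracket y (bracket (basis g) w)) hy
    (by simp) (fun y y' h h' => ?_) (fun r y h => ?_) (fun g' hg' => ?_)
  · simp only [map_add, LinearMap.add_apply, h, h', smul_add]
    abel
  · simp only [map_smul, LinearMap.smul_apply, h, smul_add]
    rw [smul_comm r]
  refine part_induct (p := fun w => bracket (basis g) (bracket (basis g') w) =
      bracket (bracket (basis g) (basis g')) w +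
        koszul a b • bracket (basis g') (bracket (basis g) w)) hw
    (by simp) (fun w w' h h' => ?_) (fun r w h => ?_) (fun g'' _ => ?_)
  · simp only [map_add, h, h', smul_add]
    abel
  · simp only [map_smul, h, smul_add]
    rw [smul_comm r]
  subst hg hg'
  simp only [bracket_basis]
  exact jacobiGen g g' g''

instance : LieSuperalgebra FV where
  part := part
  isCompl := isCompl_part
  bracket := bracket
  bracket_mem := bracket_mem
  bracket_skew := bracket_skew
  jacobi := jacobi

/-- The automorphism `σ_μ` of `𝒮(1/2)`: `L_k ↦ L_k`, `ψ_r ↦ μ ψ_r`, `c ↦ c`, `z ↦ μ² z`. -/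
def sigma (μ : ℂ) : FV →ₗ[ℂ] FV := lift fun
  | .L m => basis (.L m)
  | .psi k => μ • basis (.psi k)
  | .c => basis .c
  | .z => μ ^ 2 • basis .z

/-- The projection of `𝒮(1/2)` onto the Virasoro algebra whose kernel is the Fermion algebra
spanned by the `ψ_r` and `z`. -/
def toVir : FV →ₗ[ℂ] Vir := lift fun
  | .L m => Vir.basis (.L m)
  | .c => Vir.basis .c
  | _ => 0

/-- The module `V^{𝒮(1/2)}`: a module `V` over the Virasoro algebra, on which the Fermion algebra
acts by zero. As a graded space, `V` is placed in the single parity `p`. -/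
def inflate (V : Type*) [AddCommGroup V] [Module ℂ V] [LieRingModule Vir V] [LieModule ℂ Vir V]
    (p : ZMod 2) : SuperAction FV V where
  part a := if a = p then ⊤ else ⊥
  isCompl := by
    fin_cases p
    · change IsCompl (if (0 : ZMod 2) = 0 then (⊤ : Submodule ℂ V) else ⊥)
        (if (1 : ZMod 2) = 0 then ⊤ else ⊥)
      rw [if_pos rfl, if_neg one_ne_zero]
      exact isCompl_top_bot
    · change IsCompl (if (0 : ZMod 2) = 1 then (⊤ : Submodule ℂ V) else ⊥)
        (if (1 : ZMod 2) = 1 then ⊤ else ⊥)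
      rw [if_pos rfl, if_neg zero_ne_one]
      exact isCompl_bot_top
  act := (LieModule.toEnd ℂ Vir V : Vir →ₗ[ℂ] Module.End ℂ V) ∘ₗ toVir

variable {M : Type*} [AddCommGroup M] [Module ℂ M]

/-- The twisted module `M^μ`: `x` acts as `σ_μ(x)`. -/
def twist (A : SuperAction FV M) (μ : ℂ) : SuperAction FV M where
  part := A.part
  isCompl := A.isCompl
  act := A.act ∘ₗ sigma μ

/-- Smoothness: each vector is annihilated by `L_i` and `ψ_r` for all sufficiently large `i`
and `r`. -/
def IsSmooth (A : SuperAction FV M) : Prop :=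
  ∀ v : M, ∃ n : ℕ, ∀ i : ℤ, (n : ℤ) < i →
    A.act (basis (.L i)) v = 0 ∧ A.act (basis (.psi i)) v = 0

/-- `M` has level `ℓ` if `z` acts as the scalar `ℓ`. -/
def HasLevel (A : SuperAction FV M) (ℓ : ℂ) : Prop := ∀ v : M, A.act (basis .z) v = ℓ • v

end FV

/-! ## The Fock module `𝒱(1/2)` -/

/-- The exterior algebra on the generators `ξ_i`, `i ∈ ℕ + 1/2`; the `n`-th basis vector of
`ℕ →₀ ℂ` stands for `ξ_{n + 1/2}`. -/
abbrev Fock : Type := ExteriorAlgebra ℂ (ℕ →₀ ℂ)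

namespace Fock

/-- Multiplication by `ξ_{n + 1/2}` from the left. -/
def mulXi (n : ℕ) : Module.End ℂ Fock :=
  LinearMap.mulLeft ℂ (ExteriorAlgebra.ι ℂ (Finsupp.single n 1 : ℕ →₀ ℂ))

/-- The (left) partial derivative `∂/∂ξ_{n + 1/2}`. -/
def dXi (n : ℕ) : Module.End ℂ Fock :=
  CliffordAlgebra.contractLeft (Q := (0 : QuadraticForm ℂ (ℕ →₀ ℂ)))
    (Finsupp.lapply n : (ℕ →₀ ℂ) →ₗ[ℂ] ℂ)

/-- The operator `ψ_{k + 1/2}`: it is `∂/∂ξ_{k + 1/2}` for `k ≥ 0`, and multiplication by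
`ξ_{-(k + 1/2)}` for `k < 0`. -/
def psi : ℤ → Module.End ℂ Fock
  | .ofNat n => dXi n
  | .negSucc n => mulXi n

/-- The normally ordered product `:ψ_r ψ_s:` with `r = a + 1/2` and `s = b + 1/2`. -/
def normalOrd (a b : ℤ) : Module.End ℂ Fock :=
  if a ≤ b then psi a * psi b else -(psi b * psi a)

theorem exists_psi_eq_zero (v : Fock) : ∃ N : ℕ, ∀ a : ℤ, (N : ℤ) ≤ a → psi a v = 0 := by
  have key : ∃ N : ℕ, ∀ n, N ≤ n → dXi n v = 0 := by
    induction v using CliffordAlgebra.left_induction with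
    | algebraMap r => exact ⟨0, fun n _ => CliffordAlgebra.contractLeft_algebraMap _ _ r⟩
    | add x y hx hy =>
      obtain ⟨N, hN⟩ := hx
      obtain ⟨N', hN'⟩ := hy
      refine ⟨max N N', fun n hn => ?_⟩
      rw [map_add, hN n (le_of_max_le_left hn), hN' n (le_of_max_le_right hn), add_zero]
    | ι_mul x m hx =>
      obtain ⟨N, hN⟩ := hx
      refine ⟨max N (m.support.sup id + 1), fun n hn => ?_⟩
      have h1 : m n = 0 := by
        by_contra h
        have : n ≤ m.support.sup id := Finset.le_sup (f := id) (Finsupp.mem_support_iff.2 h)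
        have := le_of_max_le_right hn
        omega
      have h2 := hN n (le_of_max_le_left hn)
      rw [dXi] at h2 ⊢
      rw [CliffordAlgebra.contractLeft_ι_mul, h2, mul_zero, sub_zero, Finsupp.lapply_apply, h1,
        zero_smul]
  obtain ⟨N, hN⟩ := key
  refine ⟨N, fun a ha => ?_⟩
  rcases a with n | n
  · exact hN n (by simpa using ha)
  · exact absurd ha (by omega)

/-- The `j`-th term `r :ψ_{-r} ψ_{r+k}:`, with `r = j + 1/2`, of the vertex operator. -/
def virTerm (k j : ℤ) : Module.End ℂ Fock := ((j : ℂ) + 1 / 2) • normalOrd (-j - 1) (j + k)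

theorem finite_support_virTerm (k : ℤ) (v : Fock) :
    (Function.support fun j : ℤ => virTerm k j v).Finite := by
  obtain ⟨N, hN⟩ := exists_psi_eq_zero v
  refine (Set.finite_Icc (-(N : ℤ)) (N - k)).subset fun j hj => ?_
  by_contra hout
  apply hj
  have hmax : (N : ℤ) ≤ max (-j - 1) (j + k) := by
    simp only [Set.mem_Icc] at hout
    omega
  change virTerm k j v = 0
  rw [virTerm, LinearMap.smul_apply, normalOrd]
  split_ifs with h
  · rw [max_eq_right h] at hmax
    rw [Module.End.mul_apply, hN _ hmax, map_zero, smul_zero]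
  · rw [max_eq_left (le_of_not_ge h)] at hmax
    rw [LinearMap.neg_apply, Module.End.mul_apply, hN _ hmax, map_zero, neg_zero, smul_zero]

/-- The vertex operator `L̄_k = (1/2) ∑_{r ∈ ℤ + 1/2} r :ψ_{-r} ψ_{r+k}:`; on each vector the sum has
only finitely many nonzero terms. -/
def vir (k : ℤ) : Module.End ℂ Fock where
  toFun v := (1 / 2 : ℂ) • ∑ᶠ j : ℤ, virTerm k j v
  map_add' v w := by
    simp only [map_add]
    rw [finsum_add_distrib (finite_support_virTerm k v) (finite_support_virTerm k w), smul_add]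
  map_smul' r v := by
    simp only [map_smul, RingHom.id_apply]
    rw [← smul_finsum, smul_comm]

/-- The action of `𝒮(1/2)` on `𝒱(1/2)`: `ψ_r` acts as above, `L_k` as the vertex operator `L̄_k`,
`c` as `1/2` and `z` as `1`; the grading is by the parity of the degree. -/
def action : SuperAction FV Fock where
  part := CliffordAlgebra.evenOdd (0 : QuadraticForm ℂ (ℕ →₀ ℂ))
  isCompl := CliffordAlgebra.evenOdd_isCompl _
  act := FV.lift fun
    | .L k => vir k
    | .psi k => psi k
    | .c => (1 / 2 : ℂ) • (1 : Module.End ℂ Fock)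
    | .z => 1

end Fock

end

/-! ## Smooth representations of the fermion algebra -/

/-! Fix μ with μ² equal to the level. The operators μ⁻¹ψ_r satisfy the canonical anticommutation
relations, and smoothness makes the annihilation operators locally finite, so a Stone–von Neumann
argument applies: the module is Fock ⊗ (vacuum vectors), with the ψ_r acting on the first factor
(`bijective_fockMap`). The carrying facts are `eq_top` and `eq_bot`: an invariant subspace is
determined by its vacuum vectors, because peeling off one mode at a time brings any vector down to
the vacuum.

The Virasoro action then splits as in the coset construction. The vertex operator L̄_m on the Fock
factor has the same commutators with the ψ_r as L_m, so L_m - L̄_m commutes with all ψ_r and acts on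
the second factor alone (`commute_fockEquiv`). On Fock itself the commutant of the ψ_r is ℂ, hence
the L̄_m satisfy the Virasoro relations up to a scalar cocycle. The Jacobi identity and the single
value at (2, -2) give central charge 1/2 (`cocycle_formula`). Therefore L_m - L̄_m and c - 1/2
satisfy the Virasoro relations on the vacuum space (`vacOp_bracketGen`).

Finally, an invariant subspace U of the vacuum space lying in one parity yields the graded submodule
Fock ⊗ U. Simplicity applied to the even vacuum vectors forces the vacuum space into a single parity
(`exists_vacuum_le_part`). All its submodules are then homogeneous, so it is irreducible. Since the
ψ_r act by zero on it, the sign in the tensor product plays no role. -/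

/-- A family `p k` (standing for `ψ_{k + 1/2}`) of operators with the relations
`ψ_r ψ_s + ψ_s ψ_r = δ_{r,-s}` such that each vector is annihilated by all but finitely many `ψ_r`
with `r > 0`. -/
structure IsFermion {X : Type*} [AddCommGroup X] [Module ℂ X] (p : ℤ → Module.End ℂ X) : Prop where
  anticomm : ∀ (j k : ℤ) (x : X),
    p j (p k x) + p k (p j x) = (if j + k + 1 = 0 then (1 : ℂ) else 0) • x
  smooth : ∀ x : X, ∃ N : ℕ, ∀ a : ℤ, (N : ℤ) ≤ a → p a x = 0

namespace IsFermion

variable {X : Type*} [AddCommGroup X] [Module ℂ X] {p : ℤ → Module.End ℂ X}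

theorem add_eq (hp : IsFermion p) {j k : ℤ} (h : j + k + 1 = 0) (x : X) :
    p j (p k x) + p k (p j x) = x := by
  rw [hp.anticomm, if_pos h, one_smul]

theorem swap (hp : IsFermion p) {j k : ℤ} (h : j + k + 1 ≠ 0) (x : X) :
    p j (p k x) = -p k (p j x) := by
  rw [eq_neg_iff_add_eq_zero, hp.anticomm, if_neg h, zero_smul]

theorem sq (hp : IsFermion p) (j : ℤ) (x : X) : p j (p j x) = 0 := by
  have h := hp.anticomm j j x
  rw [if_neg (by omega), zero_smul, ← two_smul ℂ] at h
  exact (smul_eq_zero.1 h).resolve_left two_ne_zero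

theorem decomp (hp : IsFermion p) (n : ℤ) (x : X) :
    p n (p (-n - 1) x) + p (-n - 1) (p n x) = x := hp.add_eq (by ring) x

/-- The vacuum vectors: those annihilated by all `ψ_r` with `r > 0`. -/
def vac (p : ℤ → Module.End ℂ X) : Submodule ℂ X := ⨅ n : ℕ, LinearMap.ker (p n)

theorem mem_vac {x : X} : x ∈ vac p ↔ ∀ n : ℤ, 0 ≤ n → p n x = 0 := by
  simp only [vac, Submodule.mem_iInf, LinearMap.mem_ker]
  refine ⟨fun h n hn => ?_, fun h n => h n (by positivity)⟩
  lift n to ℕ using hn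
  exact h n

/-- Both pieces start with ψ_r for r = k + 1/2, which squares to zero; this handles `a = k`. For `a
> k` the operator `p a` anticommutes with both `p k` and `p (-k - 1)`, so it moves through to `x`.
Thus each piece needs one mode fewer than `x`. -/
theorem lower (hp : IsFermion p) {k : ℕ} {x : X} (hx : ∀ a : ℤ, ((k + 1 : ℕ) : ℤ) ≤ a → p a x = 0) :
    (∀ a : ℤ, (k : ℤ) ≤ a → p a (p k x) = 0) ∧
      ∀ a : ℤ, (k : ℤ) ≤ a → p a (p k (p (-k - 1) x)) = 0 := by
  refine ⟨fun a ha => ?_, fun a ha => ?_⟩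
  · rcases ha.eq_or_lt with rfl | h
    · exact hp.sq _ _
    · rw [hp.swap (by omega), hx a (by push_cast; omega), map_zero, neg_zero]
  · rcases ha.eq_or_lt with rfl | h
    · exact hp.sq _ _
    · rw [hp.swap (by omega), hp.swap (j := a) (by omega), hx a (by push_cast; omega), map_zero,
        neg_zero, map_zero, neg_zero]

/-- An invariant subspace containing the vacuum vectors is everything. -/
theorem eq_top (hp : IsFermion p) {W : Submodule ℂ X} (hW : ∀ a, ∀ w ∈ W, p a w ∈ W)
    (hv : vac p ≤ W) : W = ⊤ := by
  -- Induction on the number of modes not yet known to annihilate `x`: `decomp` writes `x` through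
  -- two vectors for which that number has dropped by one.
  have key : ∀ (k : ℕ) (x : X), (∀ a : ℤ, (k : ℤ) ≤ a → p a x = 0) → x ∈ W := by
    intro k
    induction k with
    | zero => exact fun x hx => hv (mem_vac.2 hx)
    | succ k ih =>
      intro x hx
      obtain ⟨h1, h2⟩ := hp.lower hx
      rw [← hp.decomp k x]
      exact add_mem (ih _ h2) (hW _ _ (ih _ h1))
  refine eq_top_iff.2 fun x _ => ?_
  obtain ⟨N, hN⟩ := hp.smooth x
  exact key N x hN

/-- An invariant subspace without nonzero vacuum vectors is zero. -/
theorem eq_bot (hp : IsFermion p) {W : Submodule ℂ X} (hW : ∀ a, ∀ w ∈ W, p a w ∈ W)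
    (hv : ∀ x ∈ W, x ∈ vac p → x = 0) : W = ⊥ := by
  have key : ∀ (k : ℕ), ∀ x ∈ W, (∀ a : ℤ, (k : ℤ) ≤ a → p a x = 0) → x = 0 := by
    intro k
    induction k with
    | zero => exact fun x hxW hx => hv x hxW (mem_vac.2 hx)
    | succ k ih =>
      intro x hxW hx
      obtain ⟨h1, h2⟩ := hp.lower hx
      rw [← hp.decomp k x, ih _ (hW _ _ (hW _ _ hxW)) h2, ih _ (hW _ _ hxW) h1, map_zero, add_zero]
  refine eq_bot_iff.2 fun x hx => ?_
  obtain ⟨N, hN⟩ := hp.smooth x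
  exact key N x hx hN

/-- The composite of the projections `ψ_r ψ_{-r}` onto `ker ψ_r` for `0 < r < k`. -/
def vacProj (p : ℤ → Module.End ℂ X) : ℕ → Module.End ℂ X
  | 0 => 1
  | k + 1 => vacProj p k * (p k * p (-k - 1))

theorem vacProj_succ (k : ℕ) (x : X) :
    vacProj p (k + 1) x = vacProj p k (p k (p (-k - 1) x)) := rfl

theorem vacProj_of_mem (hp : IsFermion p) {x : X} (hx : x ∈ vac p) (k : ℕ) : vacProj p k x = x := by
  induction k with
  | zero => rfl
  | succ k ih =>
    have h := hp.decomp k x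
    rw [mem_vac.1 hx k (by positivity), map_zero, add_zero] at h
    rw [vacProj_succ, h, ih]

/-- The product contains the factor ψ_r ψ_{-r} with r = n + 1/2, and ψ_{-r}² = 0. The other factors
are even in the ψ's and commute with ψ_{-r}, the two signs cancelling. -/
theorem vacProj_creation (hp : IsFermion p) {n k : ℕ} (h : n < k) (x : X) :
    vacProj p k (p (-n - 1) x) = 0 := by
  induction k generalizing x with
  | zero => omega
  | succ k ih =>
    rw [vacProj_succ]
    rcases (Nat.lt_succ_iff.1 h).eq_or_lt with rfl | h'
    · rw [hp.sq, map_zero, map_zero]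
    · rw [hp.swap (j := -k - 1) (by omega), map_neg, hp.swap (j := k) (by omega), neg_neg, ih h']

end IsFermion

/-! ## The Fock module as a representation of the fermion algebra -/

namespace Fock

open IsFermion

theorem psi_natCast (n : ℕ) : psi n = dXi n := rfl

theorem psi_creation (n : ℕ) : psi (-n - 1) = mulXi n := by
  rw [show (-n - 1 : ℤ) = Int.negSucc n by rw [Int.negSucc_eq]; ring]
  rfl

theorem cases_int {P : ℤ → Prop} (h1 : ∀ n : ℕ, P n) (h2 : ∀ n : ℕ, P (-n - 1)) (k : ℤ) : P k := by
  rcases k with n | n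
  · exact h1 n
  · have := h2 n
    rwa [show (-n - 1 : ℤ) = Int.negSucc n by rw [Int.negSucc_eq]; ring] at this

theorem dXi_ι_mul (n : ℕ) (m : ℕ →₀ ℂ) (x : Fock) :
    dXi n (ExteriorAlgebra.ι ℂ m * x) = m n • x - ExteriorAlgebra.ι ℂ m * dXi n x :=
  CliffordAlgebra.contractLeft_ι_mul _ _ _

theorem dXi_algebraMap (n : ℕ) (r : ℂ) : dXi n (algebraMap ℂ Fock r) = 0 :=
  CliffordAlgebra.contractLeft_algebraMap _ _ _

theorem dXi_mulXi (m n : ℕ) (x : Fock) :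
    dXi m (mulXi n x) + mulXi n (dXi m x) = (if m = n then (1 : ℂ) else 0) • x := by
  have h := dXi_ι_mul m (Finsupp.single n 1) x
  change dXi m (mulXi n x) = _ - mulXi n (dXi m x) at h
  rw [h, sub_add_cancel, Finsupp.single_apply]
  simp only [eq_comm]

theorem isFermion_psi : IsFermion psi where
  anticomm j k x := by
    induction j using cases_int with
    | h1 m =>
      induction k using cases_int with
      | h1 n =>
        rw [if_neg (by omega), zero_smul, ← eq_neg_iff_add_eq_zero]
        exact CliffordAlgebra.contractLeft_comm _ _ _
      | h2 n =>
        rw [psi_natCast, psi_creation, dXi_mulXi]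
        congr 2
        simp only [eq_iff_iff]
        omega
    | h2 m =>
      induction k using cases_int with
      | h1 n =>
        rw [psi_natCast, psi_creation, add_comm, dXi_mulXi]
        congr 2
        simp only [eq_iff_iff]
        omega
      | h2 n =>
        rw [if_neg (by omega), zero_smul, psi_creation, psi_creation]
        simp only [mulXi, LinearMap.mulLeft_apply]
        rw [← mul_assoc, ← mul_assoc, ← add_mul, ExteriorAlgebra.ι_add_mul_swap, zero_mul]
  smooth := exists_psi_eq_zero

theorem algebraMap_mem_vac (r : ℂ) : algebraMap ℂ Fock r ∈ vac psi := by
  refine mem_vac.2 fun n hn => ?_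
  lift n to ℕ using hn
  exact dXi_algebraMap n r

theorem one_mem_vac : (1 : Fock) ∈ vac psi := by
  simpa using algebraMap_mem_vac 1

/-- The vacuum expectation. -/
noncomputable abbrev vev : Fock →ₐ[ℂ] ℂ := ExteriorAlgebra.algebraMapInv

theorem vev_ι_mul (m : ℕ →₀ ℂ) (x : Fock) : vev (ExteriorAlgebra.ι ℂ m * x) = 0 := by
  rw [map_mul]
  simp [ExteriorAlgebra.algebraMapInv]

theorem vev_psi_of_neg {a : ℤ} (ha : a < 0) (x : Fock) : vev (psi a x) = 0 := by
  obtain ⟨n, rfl⟩ : ∃ n : ℕ, a = -n - 1 := ⟨(-a - 1).toNat, by omega⟩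
  rw [psi_creation]
  exact vev_ι_mul _ _

theorem ι_mul_eq_sum (m : ℕ →₀ ℂ) (x : Fock) :
    ExteriorAlgebra.ι ℂ m * x = m.sum fun n r => r • psi (-n - 1) x := by
  conv_lhs => rw [← m.sum_single, Finsupp.sum, map_sum, Finset.sum_mul]
  refine Finset.sum_congr rfl fun n _ => ?_
  change _ = m n • psi (-n - 1) x
  rw [psi_creation, ← Finsupp.smul_single_one, map_smul, smul_mul_assoc]
  rfl

/-- Constants are vacuum vectors and are fixed. A multiple of a generator `m` involves only the
modes in the finite support of `m`, so it is killed once `k` passes that support. -/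
theorem exists_vacProj_eq (x : Fock) :
    ∃ N : ℕ, ∀ k, N ≤ k → vacProj psi k x = algebraMap ℂ Fock (vev x) := by
  induction x using CliffordAlgebra.left_induction with
  | algebraMap r =>
    refine ⟨0, fun k _ => ?_⟩
    rw [isFermion_psi.vacProj_of_mem (algebraMap_mem_vac r)]
    congr 1
    exact (AlgHom.commutes vev r).symm
  | add x y hx hy =>
    obtain ⟨N, hN⟩ := hx
    obtain ⟨N', hN'⟩ := hy
    refine ⟨max N N', fun k hk => ?_⟩
    rw [map_add, hN k (le_of_max_le_left hk), hN' k (le_of_max_le_right hk), map_add, map_add]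
  | ι_mul x m _ =>
    refine ⟨m.support.sup id + 1, fun k hk => ?_⟩
    refine (?_ : _ = (0 : Fock)).trans ?_
    · refine (congrArg _ (ι_mul_eq_sum m x)).trans ?_
      rw [Finsupp.sum, map_sum]
      refine Finset.sum_eq_zero fun n hn => ?_
      have : n ≤ m.support.sup id := Finset.le_sup (f := id) hn
      rw [map_smul, isFermion_psi.vacProj_creation (by omega), smul_zero]
    · rw [vev_ι_mul, map_zero]

/-- The Fock vacuum is one-dimensional: the projections fix `x` and eventually produce a scalar. -/
theorem eq_of_mem_vac {x : Fock} (hx : x ∈ vac psi) : x = algebraMap ℂ Fock (vev x) := by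
  obtain ⟨N, hN⟩ := exists_vacProj_eq x
  rw [← hN N le_rfl, isFermion_psi.vacProj_of_mem hx]

/-- An operator commuting with all `ψ_r` is a scalar. -/
theorem eq_smul_of_commute (T : Module.End ℂ Fock) (hT : ∀ a x, T (psi a x) = psi a (T x)) :
    T = vev (T 1) • (1 : Module.End ℂ Fock) := by
  have h1 : T 1 = vev (T 1) • (1 : Fock) := by
    rw [← Algebra.algebraMap_eq_smul_one]
    refine eq_of_mem_vac (mem_vac.2 fun n hn => ?_)
    rw [← hT, mem_vac.1 one_mem_vac n hn, map_zero]
  set c := vev (T 1)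
  -- Schur-type argument: this kernel is stable under every ψ_r and contains the vacuum line.
  have key : LinearMap.ker (T - c • 1) = ⊤ := by
    refine isFermion_psi.eq_top (fun a w hw => ?_) fun x hx => ?_
    · simp only [LinearMap.mem_ker, LinearMap.sub_apply, LinearMap.smul_apply,
        Module.End.one_apply] at hw ⊢
      rw [hT, ← map_smul, ← map_sub, hw, map_zero]
    · rw [eq_of_mem_vac hx, Algebra.algebraMap_eq_smul_one]
      simp only [LinearMap.mem_ker, LinearMap.sub_apply, LinearMap.smul_apply,
        Module.End.one_apply, map_smul]
      rw [h1, sub_self, smul_zero]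
  exact sub_eq_zero.1 (LinearMap.ker_eq_top.1 key)

variable {V : Type*} [AddCommGroup V] [Module ℂ V]

theorem isFermion_rTensor : IsFermion fun a => (psi a).rTensor V where
  anticomm j k t := by
    induction t using TensorProduct.induction_on with
    | zero => simp
    | tmul x v =>
      simp only [LinearMap.rTensor_tmul]
      rw [← TensorProduct.add_tmul, isFermion_psi.anticomm, TensorProduct.smul_tmul']
    | add t t' h h' => simp only [map_add, smul_add, ← h, ← h']; abel
  smooth t := by
    induction t using TensorProduct.induction_on with
    | zero => exact ⟨0, by simp⟩
    | tmul x v =>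
      obtain ⟨N, hN⟩ := exists_psi_eq_zero x
      exact ⟨N, fun a ha => by rw [LinearMap.rTensor_tmul, hN a ha, TensorProduct.zero_tmul]⟩
    | add t t' h h' =>
      obtain ⟨N, hN⟩ := h
      obtain ⟨N', hN'⟩ := h'
      refine ⟨max N N', fun a ha => ?_⟩
      rw [map_add, hN a (by omega), hN' a (by omega), add_zero]

theorem vacProj_rTensor (k : ℕ) :
    vacProj (fun a => (psi a).rTensor V) k = (vacProj psi k).rTensor V := by
  induction k with
  | zero => exact (LinearMap.rTensor_id V Fock).symm
  | succ k ih => simp only [vacProj, LinearMap.rTensor_mul, ih]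

theorem exists_eq_one_tmul {t : Fock ⊗[ℂ] V} (ht : t ∈ vac fun a => (psi a).rTensor V) :
    ∃ v : V, t = 1 ⊗ₜ v := by
  have key : ∃ (N : ℕ) (v : V), ∀ k, N ≤ k → (vacProj psi k).rTensor V t = 1 ⊗ₜ v := by
    -- Stabilisation holds for every tensor. The vacuum hypothesis is not inherited by summands, so
    -- it must stay out of the induction.
    clear ht
    induction t using TensorProduct.induction_on with
    | zero => exact ⟨0, 0, by simp⟩
    | tmul x v =>
      obtain ⟨N, hN⟩ := exists_vacProj_eq x
      refine ⟨N, vev x • v, fun k hk => ?_⟩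
      rw [LinearMap.rTensor_tmul, hN k hk, Algebra.algebraMap_eq_smul_one, TensorProduct.smul_tmul]
    | add t t' h h' =>
      obtain ⟨N, v, hN⟩ := h
      obtain ⟨N', v', hN'⟩ := h'
      refine ⟨max N N', v + v', fun k hk => ?_⟩
      rw [map_add, hN k (by omega), hN' k (by omega), TensorProduct.tmul_add]
  obtain ⟨N, v, hN⟩ := key
  refine ⟨v, ?_⟩
  rw [← hN N le_rfl, ← vacProj_rTensor, isFermion_rTensor.vacProj_of_mem ht]

end Fock

/-! ## The Fock module is an `𝒮(1/2)`-module -/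

theorem FV.isModule_of_basis {M : Type*} [AddCommGroup M] [Module ℂ M] (A : SuperAction FV M)
    (h1 : ∀ g a, ∀ v ∈ A.part a, A.act (basis g) v ∈ A.part (g.parity + a))
    (h2 : ∀ g g' v, A.act (bracketGen g g') v = A.act (basis g) (A.act (basis g') v)
      - koszul g.parity g'.parity • A.act (basis g') (A.act (basis g) v)) : A.IsModule where
  act_mem {a b x v} hx hv := by
    refine part_induct (p := fun x => A.act x v ∈ A.part (a + b)) hx (by simp)
      (fun x y h h' => ?_) (fun r x h => ?_) fun g hg => hg ▸ h1 g b v hv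
    · rw [map_add]
      exact add_mem h h'
    · rw [map_smul]
      exact Submodule.smul_mem _ _ h
  act_bracket {a b x y} hx hy v := by
    change A.act (bracket x y) v = _
    refine part_induct (p := fun x => A.act (bracket x y) v =
      A.act x (A.act y v) - koszul a b • A.act y (A.act x v)) hx (by simp)
      (fun x x' h h' => ?_) (fun r x h => ?_) fun g hg => ?_
    · simp only [map_add, LinearMap.add_apply, h, h', smul_add]
      abel
    · simp only [map_smul, LinearMap.smul_apply, h, smul_sub]
      rw [smul_comm r]
    refine part_induct (p := fun y => A.act (bracket (basis g) y) v =
      A.act (basis g) (A.act y v) - koszul a b • A.act y (A.act (basis g) v)) hy (by simp)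
      (fun x x' h h' => ?_) (fun r x h => ?_) fun g' hg' => ?_
    · simp only [map_add, LinearMap.add_apply, h, h', smul_add]
      abel
    · simp only [map_smul, LinearMap.smul_apply, h, smul_sub]
      rw [smul_comm r]
    subst hg hg'
    rw [bracket_basis]
    exact h2 g g' v

namespace Fock

open IsFermion

theorem psi_one_of_nonneg {a : ℤ} (ha : 0 ≤ a) : psi a 1 = 0 := mem_vac.1 one_mem_vac a ha

/-- ψ_a ψ_b and -ψ_b ψ_a differ by a scalar, so both branches of the normal ordering have the same
commutator with ψ_i. -/
theorem normalOrd_psi (a b i : ℤ) (v : Fock) :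
    normalOrd a b (psi i v) = psi i (normalOrd a b v)
      + (if b + i + 1 = 0 then (1 : ℂ) else 0) • psi a v
      - (if a + i + 1 = 0 then (1 : ℂ) else 0) • psi b v := by
  have h : ∀ a b : ℤ, psi a (psi b (psi i v)) = psi i (psi a (psi b v))
      + (if b + i + 1 = 0 then (1 : ℂ) else 0) • psi a v
      - (if a + i + 1 = 0 then (1 : ℂ) else 0) • psi b v := fun a b => by
    rw [eq_sub_of_add_eq (isFermion_psi.anticomm b i v), map_sub, map_smul,
      eq_sub_of_add_eq (isFermion_psi.anticomm a i (psi b v))]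
    abel
  unfold normalOrd
  by_cases hab : a ≤ b
  · simp only [if_pos hab, Module.End.mul_apply]
    exact h a b
  · simp only [if_neg hab, LinearMap.neg_apply, Module.End.mul_apply, h b a, map_neg]
    abel

theorem virTerm_psi (k j i : ℤ) (v : Fock) :
    virTerm k j (psi i v) = psi i (virTerm k j v)
      + (if j = -k - i - 1 then (-(i : ℂ) - k - 1 / 2) • psi (k + i) v else 0)
      - (if j = i then ((i : ℂ) + 1 / 2) • psi (k + i) v else 0) := by
  simp only [virTerm, LinearMap.smul_apply, normalOrd_psi, map_smul, smul_sub, smul_add]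
  congr 1
  · congr 1
    by_cases h : j = -k - i - 1
    · rw [if_pos h, if_pos (by omega), one_smul, h, show -(-k - i - 1) - 1 = k + i by ring]
      push_cast
      congr 1
      ring
    · rw [if_neg h, if_neg (by omega), zero_smul, smul_zero]
  · by_cases h : j = i
    · rw [if_pos h, if_pos (by omega), one_smul, h, add_comm i k]
    · rw [if_neg h, if_neg (by omega), zero_smul, smul_zero]

theorem vir_apply (k : ℤ) (v : Fock) : vir k v = (1 / 2 : ℂ) • ∑ᶠ j : ℤ, virTerm k j v := rfl

/-- Only the terms `j = -k - i - 1` and `j = i` fail to commute with `psi i`. Both give multiples of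
`psi (k + i)`, and half the sum of their coefficients is the stated one. -/
theorem vir_psi (k i : ℤ) (v : Fock) :
    vir k (psi i v) = psi i (vir k v) + (-((i : ℂ) + 1 / 2) - (k : ℂ) / 2) • psi (k + i) v := by
  have f1 : (Function.support fun j : ℤ => psi i (virTerm k j v)).Finite :=
    (finite_support_virTerm k v).subset fun j hj h => hj (by
      change psi i (virTerm k j v) = 0
      rw [show virTerm k j v = 0 from h, map_zero])
  have f2 : ∀ (b : ℤ) (x : Fock), (Function.support fun j : ℤ => if j = b then x else 0).Finite :=
    fun b x => (Set.finite_singleton b).subset fun j hj => by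
      by_contra h
      exact hj (if_neg h)
  have f12 : ∀ (b : ℤ) (x : Fock), (Function.support fun j : ℤ =>
      psi i (virTerm k j v) + if j = b then x else 0).Finite := fun b x =>
    (f1.union (f2 b x)).subset (Function.support_add _ _)
  simp only [vir_apply, virTerm_psi]
  rw [finsum_sub_distrib (f12 _ _) (f2 _ _), finsum_add_distrib f1 (f2 _ _),
    ← map_finsum _ (finite_support_virTerm k v),
    finsum_eq_single _ (-k - i - 1) fun j hj => if_neg hj,
    finsum_eq_single _ i fun j hj => if_neg hj, if_pos rfl, if_pos rfl, map_smul]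
  module

theorem vir_eq_zero {k : ℤ} {v : Fock} (h : ∀ a b : ℤ, a + b = k - 1 → a ≤ b → psi a (psi b v) = 0) :
    vir k v = 0 := by
  rw [vir_apply, finsum_eq_zero_of_forall_eq_zero, smul_zero]
  intro j
  rw [virTerm, LinearMap.smul_apply, normalOrd]
  split_ifs with hab
  · rw [Module.End.mul_apply, h _ _ (by ring) hab, smul_zero]
  · rw [LinearMap.neg_apply, Module.End.mul_apply, h _ _ (by ring) (by omega), neg_zero, smul_zero]

/-- The indices sum to k - 1 ≥ -2, so the right-hand operator annihilates the vacuum unless both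
indices are -1, where ψ_{-1/2}² = 0. The bound is sharp, as `vir_neg_two_one` shows. -/
theorem vir_one {k : ℤ} (hk : -1 ≤ k) : vir k 1 = 0 := by
  refine vir_eq_zero fun a b hab hle => ?_
  by_cases hb : 0 ≤ b
  · rw [psi_one_of_nonneg hb, map_zero]
  · obtain rfl : a = b := by omega
    exact isFermion_psi.sq _ _

/-- The indices sum to k - 1 < 0, so normal ordering leaves a creation operator leftmost, and its
image has no constant term. -/
theorem vev_vir {k : ℤ} (hk : k ≤ 0) (v : Fock) : vev (vir k v) = 0 := by
  rw [vir_apply, map_smul, map_finsum _ (finite_support_virTerm k v),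
    finsum_eq_zero_of_forall_eq_zero, smul_zero]
  intro j
  rw [virTerm, LinearMap.smul_apply, normalOrd, map_smul]
  split_ifs with hab
  · rw [Module.End.mul_apply, vev_psi_of_neg (by omega), smul_zero]
  · rw [LinearMap.neg_apply, Module.End.mul_apply, map_neg, vev_psi_of_neg (by omega), neg_zero,
      smul_zero]

theorem vir_neg_two_one : vir (-2) 1 = (1 / 2 : ℂ) • psi (-2) (psi (-1) 1) := by
  -- The indices sum to -3; unless they are -1 and -2 in some order, the larger one is nonnegative
  -- and stands on the right.
  have h : ∀ j : ℤ, j ∉ ({0, 1} : Finset ℤ) → virTerm (-2) j 1 = 0 := by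
    intro j hj
    simp only [Finset.mem_insert, Finset.mem_singleton, not_or] at hj
    rw [virTerm, LinearMap.smul_apply, normalOrd]
    split_ifs with hab
    · rw [Module.End.mul_apply, psi_one_of_nonneg (by omega), map_zero, smul_zero]
    · rw [LinearMap.neg_apply, Module.End.mul_apply, psi_one_of_nonneg (by omega), map_zero,
        neg_zero, smul_zero]
  rw [vir_apply, finsum_eq_sum_of_support_subset (s := {0, 1}) _ fun j hj => by
    by_contra h'
    exact hj (h j h')]
  rw [Finset.sum_pair (by decide)]
  simp only [virTerm, normalOrd, LinearMap.smul_apply]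
  rw [if_neg (by decide), if_pos (by decide)]
  simp only [LinearMap.neg_apply, Module.End.mul_apply]
  norm_num
  module

/-- This fixes the central charge: (m³ - m)/12 · c at m = 2 is c/2, hence c = 1/2. -/
theorem vir_two_vir_neg_two_one : vev (vir 2 (vir (-2) 1)) = 1 / 4 := by
  have h : psi 0 (psi (-1) (1 : Fock)) = 1 := by
    have := isFermion_psi.decomp 0 (1 : Fock)
    rw [psi_one_of_nonneg le_rfl, map_zero, add_zero] at this
    exact this
  rw [vir_neg_two_one, map_smul, vir_psi, vir_psi, vir_one (by decide), map_zero, zero_add,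
    show (2 + -1 : ℤ) = 1 by decide, show (2 + -2 : ℤ) = 0 by decide, h,
    psi_one_of_nonneg zero_le_one, smul_zero, map_zero, zero_add, map_smul, map_smul, map_one]
  norm_num

/-! ### The scalar cocycle and the central charge of the vertex operators -/

/-- The value of the cocycle `[L_m, L_n] - (m - n) L_{m+n}`. -/
noncomputable def cocycle (m n : ℤ) : ℂ := vev (vir m (vir n 1) - vir n (vir m 1) - ((m : ℂ) - n) • vir (m + n) 1)

/-- By `vir_psi` the defect of the Witt relation commutes with every ψ_r, so it is a scalar, read
off on the vacuum. -/
theorem vir_comm_apply (m n : ℤ) (v : Fock) :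
    vir m (vir n v) - vir n (vir m v) = ((m : ℂ) - n) • vir (m + n) v + cocycle m n • v := by
  have h := eq_smul_of_commute (vir m * vir n - vir n * vir m - ((m : ℂ) - n) • vir (m + n))
    fun a x => by
      simp only [LinearMap.sub_apply, Module.End.mul_apply, LinearMap.smul_apply,
        vir_psi, map_add, map_sub, map_smul, smul_add]
      rw [show m + (n + a) = m + n + a by ring, show n + (m + a) = m + n + a by ring]
      push_cast
      module
  exact sub_eq_iff_eq_add'.1 (LinearMap.congr_fun h v)

theorem vev_vir_one (k : ℤ) : vev (vir k 1) = 0 := by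
  rcases le_total k 0 with h | h
  · exact vev_vir h 1
  · rw [vir_one (by omega), map_zero]

theorem cocycle_eq (m n : ℤ) : cocycle m n = vev (vir m (vir n 1)) - vev (vir n (vir m 1)) := by
  rw [cocycle, map_sub, map_sub, map_smul, vev_vir_one, smul_zero, sub_zero]

theorem cocycle_swap (m n : ℤ) : cocycle m n = -cocycle n m := by
  rw [cocycle_eq, cocycle_eq, neg_sub]

theorem cocycle_zero_left (k : ℤ) : cocycle 0 k = 0 := by
  rw [cocycle_eq, vev_vir le_rfl, vir_one (k := 0) (by decide), map_zero, map_zero, sub_zero]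

theorem cocycle_jacobi (l m n : ℤ) :
    ((m : ℂ) - n) * cocycle l (m + n) + ((n : ℂ) - l) * cocycle m (n + l)
      + ((l : ℂ) - m) * cocycle n (l + m) = 0 := by
  -- The vacuum expectation of [L̄_a, [L̄_b, L̄_c]]: the scalar part of the inner commutator drops
  -- out, and `vev (vir k 1) = 0` removes the Witt part of the outer one. The cyclic sum of these
  -- double commutators vanishes.
  have hc : ∀ a b c : ℤ, vev (vir a (vir b (vir c 1) - vir c (vir b 1))
      - (vir b (vir c (vir a 1)) - vir c (vir b (vir a 1)))) = ((b : ℂ) - c) * cocycle a (b + c) := by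
    intro a b c
    rw [vir_comm_apply, vir_comm_apply, map_add, map_smul, map_smul, cocycle_eq a]
    simp only [map_sub, map_add, map_smul, vev_vir_one, smul_eq_mul]
    ring
  rw [← hc, ← hc, ← hc, ← map_add, ← map_add]
  convert map_zero vev
  simp only [map_sub]
  abel

theorem cocycle_of_ne {m n : ℤ} (h : m + n ≠ 0) : cocycle m n = 0 := by
  -- Weight argument: pairing with L̄_0 multiplies the cocycle by m + n.
  have := cocycle_jacobi 0 m n
  rw [cocycle_zero_left, add_zero, zero_add, cocycle_swap n m] at this
  have h2 : ((m + n : ℤ) : ℂ) * cocycle m n = 0 := by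
    push_cast at this ⊢
    linear_combination this
  exact (mul_eq_zero.1 h2).resolve_left (by exact_mod_cast h)

theorem cocycle_neg_natCast (n : ℕ) : cocycle (n : ℤ) (-n) = ((n : ℂ) ^ 3 - n) / 24 := by
  have h1 : cocycle 1 (-1) = 0 := by
    rw [cocycle_eq, vir_one (k := -1) le_rfl, vir_one (k := 1) (by decide)]
    simp
  induction n with
  | zero => simpa using cocycle_zero_left 0
  | succ n ih =>
    -- The Jacobi identity for (1, n, -n-1) gives (n - 1) c(n+1, -n-1) = (n + 2) c(n, -n). It says
    -- nothing about c(2, -2) at n = 1, so that value is computed directly.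
    rcases lt_trichotomy n 1 with hn | rfl | hn
    · obtain rfl : n = 0 := by omega
      simpa using h1
    · norm_num
      rw [cocycle_eq, vir_two_vir_neg_two_one, vir_one (k := 2) (by decide), map_zero, map_zero]
      norm_num
    · have h := cocycle_jacobi 1 n (-n - 1)
      rw [show (n + (-n - 1) : ℤ) = -1 by ring, h1, show (-n - 1 + 1 : ℤ) = -n by ring, ih,
        cocycle_swap, show (-n - 1 : ℤ) = -((n + 1 : ℕ) : ℤ) by push_cast; ring,
        show (1 + n : ℤ) = (n + 1 : ℕ) by push_cast; ring] at h
      have hn' : (n : ℂ) - 1 ≠ 0 := by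
        rw [sub_ne_zero]
        exact_mod_cast hn.ne'
      refine mul_left_cancel₀ hn' ?_
      push_cast at h ⊢
      linear_combination h

theorem cocycle_formula (m n : ℤ) :
    cocycle m n = if m + n = 0 then ((m : ℂ) ^ 3 - m) / 24 else 0 := by
  split_ifs with h
  · obtain rfl : n = -m := by omega
    obtain ⟨k, rfl | rfl⟩ := m.eq_nat_or_neg
    · exact_mod_cast cocycle_neg_natCast k
    · rw [neg_neg, cocycle_swap, cocycle_neg_natCast]
      push_cast
      ring
  · exact cocycle_of_ne h

/-! ### Parity of the operators and the module axioms for the Fock module and its twists -/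

theorem psi_mem_evenOdd (k : ℤ) {a : ZMod 2} {v : Fock} (hv : v ∈ action.part a) :
    psi k v ∈ action.part (1 + a) := by
  have hmul : ∀ (m : ℕ →₀ ℂ) {b : ZMod 2} {w : Fock}, w ∈ action.part b →
      ExteriorAlgebra.ι ℂ m * w ∈ action.part (1 + b) := fun m b w hw =>
    CliffordAlgebra.evenOdd_mul_le _ _ _
      (Submodule.mul_mem_mul (CliffordAlgebra.ι_mem_evenOdd_one _ _) hw)
  have h2 : ∀ b : ZMod 2, 1 + (1 + b) = b := by decide
  induction k using cases_int with
  | h2 n =>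
    rw [psi_creation]
    exact hmul _ hv
  | h1 n =>
    rw [psi_natCast]
    refine CliffordAlgebra.evenOdd_induction (0 : QuadraticForm ℂ (ℕ →₀ ℂ)) a
      (motive := fun x _ => dXi n x ∈ action.part (1 + a)) ?_ ?_ ?_ v hv
    · intro x hx
      fin_cases a
      · change x ∈ _ ^ 0 at hx
        rw [pow_zero, Submodule.mem_one] at hx
        obtain ⟨r, rfl⟩ := hx
        exact (dXi_algebraMap n r) ▸ Submodule.zero_mem _
      · change x ∈ _ ^ 1 at hx
        rw [pow_one] at hx
        obtain ⟨m, rfl⟩ := hx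
        have := dXi_ι_mul n m 1
        rw [mul_one, ← map_one (algebraMap ℂ Fock), dXi_algebraMap, mul_zero, sub_zero,
          map_one] at this
        refine this ▸ Submodule.smul_mem _ _ ?_
        exact SetLike.GradedOne.one_mem
          (A := CliffordAlgebra.evenOdd (0 : QuadraticForm ℂ (ℕ →₀ ℂ)))
    · intro x y _ _ hx hy
      rw [map_add]
      exact add_mem hx hy
    · intro m₁ m₂ x hx hdx
      rw [mul_assoc]
      have := dXi_ι_mul n m₁ (ExteriorAlgebra.ι ℂ m₂ * x)
      refine this ▸ sub_mem (Submodule.smul_mem _ _ (hmul _ hx)) (hmul _ ?_)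
      rw [dXi_ι_mul]
      refine sub_mem (Submodule.smul_mem _ _ hx) ?_
      simpa only [h2] using hmul m₂ hdx

theorem vir_mem_evenOdd (k : ℤ) {a : ZMod 2} {v : Fock} (hv : v ∈ action.part a) :
    vir k v ∈ action.part a := by
  have h2 : 1 + (1 + a) = a := by
    clear hv
    revert a
    decide
  have h : ∀ i j, psi i (psi j v) ∈ action.part a := fun i j => by
    simpa only [h2] using psi_mem_evenOdd i (psi_mem_evenOdd j hv)
  rw [vir_apply]
  refine Submodule.smul_mem _ _ ?_
  rw [finsum_eq_sum _ (finite_support_virTerm k v)]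
  refine Submodule.sum_mem _ fun j _ => ?_
  rw [virTerm, LinearMap.smul_apply, normalOrd]
  refine Submodule.smul_mem _ _ ?_
  split_ifs
  · exact h _ _
  · exact Submodule.neg_mem _ (h _ _)

theorem isModule_action : action.IsModule := by
  refine FV.isModule_of_basis _ (fun g a v hv => ?_) fun g g' v => ?_
  · rcases g with m | k | _ | _ <;> simp only [action, FV.lift_basis, FVGen.parity, zero_add]
    · exact vir_mem_evenOdd m hv
    · exact psi_mem_evenOdd k hv
    · exact Submodule.smul_mem _ _ hv
    · exact hv
  · rcases g with m | j | _ | _ <;> rcases g' with n | k | _ | _ <;>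
      simp only [FV.bracketGen, action, FV.lift_basis, FVGen.parity, map_add, map_smul, map_zero,
        LinearMap.add_apply, LinearMap.smul_apply, LinearMap.zero_apply, Module.End.one_apply,
        koszul, zero_ne_one, false_and, and_false, if_false, and_self, if_true, one_smul, sub_self,
        neg_smul, sub_neg_eq_add]
    · rw [vir_comm_apply, cocycle_formula]
      split_ifs
      · module
      · module
    · rw [vir_psi]
      module
    · rw [vir_psi]
      module
    · rw [isFermion_psi.anticomm]

theorem isModule_twist_action (μ : ℂ) : (FV.twist action μ).IsModule := by
  have hm := isModule_action
  refine FV.isModule_of_basis _ (fun g a v hv => ?_) fun g g' v => ?_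
  · have : FV.sigma μ (FV.basis g) ∈ FV.part g.parity := by
      rcases g with m | k | _ | _ <;> simp only [FV.sigma, FV.lift_basis]
      · exact FV.basis_mem_part _
      · exact Submodule.smul_mem _ _ (FV.basis_mem_part _)
      · exact FV.basis_mem_part _
      · exact Submodule.smul_mem _ _ (FV.basis_mem_part _)
    exact hm.act_mem this hv
  · have h := hm.act_bracket (FV.basis_mem_part g) (FV.basis_mem_part g') v
    change action.act (FV.bracket _ _) v = _ at h
    rw [FV.bracket_basis] at h
    simp only [FV.twist, LinearMap.comp_apply]
    rcases g with m | j | _ | _ <;> rcases g' with n | k | _ | _ <;>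
      simp only [FV.bracketGen, FV.sigma, FV.lift_basis, map_add, map_smul, map_zero,
        LinearMap.add_apply, LinearMap.smul_apply, LinearMap.zero_apply] at h ⊢
    -- Giving each ψ weight 1 and each z weight 2, every twisted relation is the untwisted one times
    -- μ to the total weight, at most 4.
    all_goals first
      | exact h
      | linear_combination (norm := module) μ • h
      | linear_combination (norm := module) μ ^ 2 • h
      | linear_combination (norm := module) μ ^ 3 • h
      | linear_combination (norm := module) μ ^ 4 • h

end Fock

/-! ## Fermion representations are multiples of the Fock module -/

namespace IsFermion

open Fock

variable {X : Type*} [AddCommGroup X] [Module ℂ X] {p : ℤ → Module.End ℂ X}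

/-- The action of `∑ m_n ξ_n` on `X`. -/
noncomputable def creation (p : ℤ → Module.End ℂ X) : (ℕ →₀ ℂ) →ₗ[ℂ] Module.End ℂ X :=
  Finsupp.linearCombination ℂ fun n : ℕ => p (-n - 1)

theorem creation_single (n : ℕ) : creation p (Finsupp.single n 1) = p (-n - 1) := by
  simp [creation]

theorem annihilation_creation (hp : IsFermion p) (n : ℕ) (m : ℕ →₀ ℂ) (x : X) :
    p n (creation p m x) = m n • x - creation p m (p n x) := by
  induction m using Finsupp.induction_linear with
  | zero => simp
  | add m m' h h' => simp only [map_add, LinearMap.add_apply, h, h', Finsupp.add_apply]; module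
  | single k r =>
    have h := congrArg (r • ·) (hp.anticomm n (-k - 1) x)
    have h2 : ((Finsupp.single k r : ℕ →₀ ℂ) n) • x =
        r • (if (n : ℤ) + (-k - 1) + 1 = 0 then (1 : ℂ) else 0) • x := by
      rw [Finsupp.single_apply, smul_smul, mul_ite, mul_one, mul_zero]
      congr 2
      simp only [eq_iff_iff]
      omega
    rw [h2, ← h, ← Finsupp.smul_single_one, map_smul, creation_single]
    simp

theorem creation_anticomm (hp : IsFermion p) (m m' : ℕ →₀ ℂ) (x : X) :
    creation p m (creation p m' x) + creation p m' (creation p m x) = 0 := by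
  induction m using Finsupp.induction_linear with
  | zero => simp
  | add m n h h' =>
    simp only [map_add, LinearMap.add_apply]
    rw [add_add_add_comm, h, h', add_zero]
  | single k r =>
    induction m' using Finsupp.induction_linear with
    | zero => simp
    | add m n h h' =>
      simp only [map_add, LinearMap.add_apply]
      rw [add_add_add_comm, h, h', add_zero]
    | single l s =>
      rw [← Finsupp.smul_single_one k, ← Finsupp.smul_single_one l, map_smul, map_smul,
        creation_single, creation_single]
      simp only [LinearMap.smul_apply, map_smul]
      rw [hp.swap (by omega)]
      module

theorem creation_mul_self (hp : IsFermion p) (m : ℕ →₀ ℂ) : creation p m * creation p m = 0 := by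
  ext x
  have h := hp.creation_anticomm m m x
  rw [← two_smul ℂ] at h
  exact (smul_eq_zero.1 h).resolve_left two_ne_zero

/-- The action of the exterior algebra on `X`. -/
noncomputable def rho (hp : IsFermion p) : Fock →ₐ[ℂ] Module.End ℂ X :=
  ExteriorAlgebra.lift ℂ ⟨creation p, hp.creation_mul_self⟩

theorem rho_ι_mul (hp : IsFermion p) (m : ℕ →₀ ℂ) (x : Fock) (w : X) :
    hp.rho (ExteriorAlgebra.ι ℂ m * x) w = creation p m (hp.rho x w) := by
  rw [map_mul, rho, ExteriorAlgebra.lift_ι_apply]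
  rfl

/-- The map `x ⊗ v ↦ x v` from the product of the Fock module and the space of vacuum vectors. -/
noncomputable def fockMap (hp : IsFermion p) : Fock ⊗[ℂ] vac p →ₗ[ℂ] X :=
  TensorProduct.lift (LinearMap.lcomp ℂ X (vac p).subtype ∘ₗ hp.rho.toLinearMap)

theorem fockMap_tmul (hp : IsFermion p) (x : Fock) (v : vac p) :
    hp.fockMap (x ⊗ₜ v) = hp.rho x v := rfl

theorem fockMap_one_tmul (hp : IsFermion p) (v : vac p) : hp.fockMap (1 ⊗ₜ v) = v := by
  rw [fockMap_tmul, map_one]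
  rfl

/-- Annihilation operators obey the same recursion on both sides when moved past a creation
operator; the recursion ends at constants, where `v` being a vacuum vector is needed. -/
theorem rho_psi (hp : IsFermion p) (a : ℤ) (x : Fock) {v : X} (hv : v ∈ vac p) :
    hp.rho (psi a x) v = p a (hp.rho x v) := by
  induction a using cases_int with
  | h2 n =>
    rw [psi_creation, mulXi, LinearMap.mulLeft_apply, rho_ι_mul, creation_single]
  | h1 n =>
    rw [psi_natCast]
    induction x using CliffordAlgebra.left_induction with
    | algebraMap r =>
      refine (LinearMap.congr_fun (congrArg hp.rho (dXi_algebraMap n r)) v).trans ?_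
      have h : hp.rho (algebraMap ℂ Fock r) v = r • v := by
        rw [AlgHom.commutes]
        rfl
      refine Eq.trans ?_ (congrArg (p n) h).symm
      rw [map_zero, map_smul, mem_vac.1 hv n (by positivity), smul_zero]
      rfl
    | add x y hx hy => simp only [map_add, LinearMap.add_apply, hx, hy]
    | ι_mul x m hx =>
      refine (LinearMap.congr_fun (congrArg hp.rho (dXi_ι_mul n m x)) v).trans ?_
      refine Eq.trans ?_ (congrArg (p n) (hp.rho_ι_mul m x v)).symm
      rw [hp.annihilation_creation, ← hx, map_sub, map_smul, LinearMap.sub_apply, rho_ι_mul]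
      rfl

theorem fockMap_psi (hp : IsFermion p) (a : ℤ) (t : Fock ⊗[ℂ] vac p) :
    hp.fockMap ((psi a).rTensor _ t) = p a (hp.fockMap t) := by
  induction t using TensorProduct.induction_on with
  | zero => simp
  | tmul x v => rw [LinearMap.rTensor_tmul, fockMap_tmul, fockMap_tmul, hp.rho_psi a x v.2]
  | add t t' h h' => simp only [map_add, h, h']

/-- Vacuum vectors of the tensor product have the form 1 ⊗ v and go to `v`, so the invariant kernel
contains no nonzero one and vanishes. The range is invariant and contains the vacuum. -/
theorem bijective_fockMap (hp : IsFermion p) : Function.Bijective hp.fockMap := by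
  constructor
  · refine LinearMap.ker_eq_bot.1 ((isFermion_rTensor (V := vac p)).eq_bot (fun a w hw => ?_)
      fun t ht hv => ?_)
    · rw [LinearMap.mem_ker] at hw ⊢
      rw [fockMap_psi, hw, map_zero]
    · obtain ⟨v, rfl⟩ := exists_eq_one_tmul hv
      rw [LinearMap.mem_ker, fockMap_one_tmul, Submodule.coe_eq_zero] at ht
      rw [ht, TensorProduct.tmul_zero]
  · refine LinearMap.range_eq_top.1 (hp.eq_top ?_ fun x hx => ⟨1 ⊗ₜ ⟨x, hx⟩, fockMap_one_tmul _ _⟩)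
    rintro a _ ⟨t, rfl⟩
    exact ⟨_, hp.fockMap_psi a t⟩

/-- The isomorphism of a fermion representation with a multiple of the Fock module. -/
noncomputable def fockEquiv (hp : IsFermion p) : Fock ⊗[ℂ] vac p ≃ₗ[ℂ] X :=
  LinearEquiv.ofBijective hp.fockMap hp.bijective_fockMap

theorem fockEquiv_tmul (hp : IsFermion p) (x : Fock) (v : vac p) :
    hp.fockEquiv (x ⊗ₜ v) = hp.rho x v := rfl

theorem fockEquiv_one_tmul (hp : IsFermion p) (v : vac p) : hp.fockEquiv (1 ⊗ₜ v) = v :=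
  hp.fockMap_one_tmul v

theorem fockEquiv_psi (hp : IsFermion p) (a : ℤ) (t : Fock ⊗[ℂ] vac p) :
    hp.fockEquiv ((psi a).rTensor _ t) = p a (hp.fockEquiv t) := hp.fockMap_psi a t

theorem mem_vac_of_commute {D : Module.End ℂ X} (hD : ∀ a x, D (p a x) = p a (D x)) :
    ∀ x ∈ vac p, D x ∈ vac p := fun x hx =>
  mem_vac.2 fun n hn => by rw [← hD, mem_vac.1 hx n hn, map_zero]

/-- An operator commuting with all `ψ_r` acts on the second factor of `Fock ⊗ vac p`. -/
theorem commute_fockEquiv (hp : IsFermion p) {D : Module.End ℂ X}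
    (hD : ∀ a x, D (p a x) = p a (D x)) (t : Fock ⊗[ℂ] vac p) :
    D (hp.fockEquiv t)
      = hp.fockEquiv ((D.restrict (mem_vac_of_commute hD)).lTensor Fock t) := by
  set T := D.restrict (mem_vac_of_commute hD)
  -- The two sides agree on vacuum tensors 1 ⊗ v, and the subspace where they agree is stable under
  -- the ψ_r.
  have key : LinearMap.ker (D ∘ₗ hp.fockEquiv.toLinearMap
      - hp.fockEquiv.toLinearMap ∘ₗ T.lTensor Fock) = ⊤ := by
    refine (isFermion_rTensor (V := vac p)).eq_top (fun a w hw => ?_) fun t ht => ?_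
    · simp only [LinearMap.mem_ker, LinearMap.sub_apply, LinearMap.comp_apply,
        LinearEquiv.coe_coe, sub_eq_zero] at hw ⊢
      have hc : T.lTensor Fock ((psi a).rTensor _ w) = (psi a).rTensor _ (T.lTensor Fock w) := by
        simp only [← LinearMap.comp_apply, LinearMap.lTensor_comp_rTensor,
          LinearMap.rTensor_comp_lTensor]
      rw [hc, fockEquiv_psi, fockEquiv_psi, hD, hw]
    · obtain ⟨v, rfl⟩ := exists_eq_one_tmul ht
      simp only [LinearMap.mem_ker, LinearMap.sub_apply, LinearMap.comp_apply,
        LinearEquiv.coe_coe, LinearMap.lTensor_tmul, fockEquiv_one_tmul, sub_eq_zero]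
      rfl
  exact sub_eq_zero.1 (LinearMap.congr_fun (LinearMap.ker_eq_top.1 key) t)

/-- The operator corresponding to `L̄_k ⊗ 1` under the isomorphism with `Fock ⊗ vac p`. -/
noncomputable def virOp (hp : IsFermion p) (k : ℤ) : Module.End ℂ X :=
  hp.fockEquiv.toLinearMap ∘ₗ (vir k).rTensor (vac p) ∘ₗ hp.fockEquiv.symm.toLinearMap

theorem virOp_fockEquiv (hp : IsFermion p) (k : ℤ) (t : Fock ⊗[ℂ] vac p) :
    hp.virOp k (hp.fockEquiv t) = hp.fockEquiv ((vir k).rTensor _ t) := by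
  simp [virOp]

/-- These are also the commutators of L_k with the rescaled ψ's (`act_L_fermion`), which is why L_k
minus this operator commutes with them. -/
theorem virOp_psi (hp : IsFermion p) (k a : ℤ) (x : X) :
    hp.virOp k (p a x)
      = p a (hp.virOp k x) + (-((a : ℂ) + 1 / 2) - (k : ℂ) / 2) • p (k + a) x := by
  obtain ⟨t, rfl⟩ := hp.fockEquiv.surjective x
  rw [← fockEquiv_psi, ← fockEquiv_psi, virOp_fockEquiv, virOp_fockEquiv, ← fockEquiv_psi,
    ← map_smul, ← map_add]
  congr 1
  induction t using TensorProduct.induction_on with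
  | zero => simp
  | tmul x v =>
    simp only [LinearMap.rTensor_tmul, vir_psi, TensorProduct.add_tmul, TensorProduct.smul_tmul']
  | add t t' h h' => simp only [map_add, h, h', smul_add]; abel

end IsFermion

/-! ## Modules over the Virasoro algebra from operators -/

namespace Vir

variable {V : Type*} [AddCommGroup V] [Module ℂ V]

/-- The module over the Virasoro algebra defined by operators with the required commutators. -/
@[reducible] noncomputable def lieRingModuleOfGen (f : VirGen → Module.End ℂ V)
    (hf : ∀ g g' v, lift f (bracketGen g g') v = f g (f g' v) - f g' (f g v)) :
    LieRingModule Vir V where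
  bracket x v := lift f x v
  add_lie x y v := by rw [map_add, LinearMap.add_apply]
  lie_add x v w := map_add _ v w
  leibniz_lie x y v := by
    change lift f x (lift f y v) = lift f (bracket x y) v + lift f y (lift f x v)
    induction x using induct with
    | h0 => simp
    | hadd x x' hx hx' => simp only [map_add, LinearMap.add_apply, hx, hx']; abel
    | hs r g =>
    induction y using induct with
    | h0 => simp
    | hadd y y' hy hy' => simp only [map_add, LinearMap.add_apply, hy, hy']; abel
    | hs s g' =>
    have h : bracket (basis g) (basis g') = bracketGen g g' := by simp [bracket]
    simp only [map_smul, LinearMap.smul_apply, h, hf, lift_basis]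
    module

theorem lieModuleOfGen (f : VirGen → Module.End ℂ V)
    (hf : ∀ g g' v, lift f (bracketGen g g') v = f g (f g' v) - f g' (f g v)) :
    letI := lieRingModuleOfGen f hf
    LieModule ℂ Vir V :=
  letI := lieRingModuleOfGen f hf
  { smul_lie := fun r x v => by
      change lift f (r • x) v = r • lift f x v
      rw [map_smul, LinearMap.smul_apply]
    lie_smul := fun r x v => map_smul (lift f x) r v }

end Vir

/-! ## Smooth modules of nonzero level -/

/-- A smooth `𝒮(1/2)`-module of level `μ²` with `μ ≠ 0`. -/
structure FV.IsSmoothOfLevelSq {M : Type*} [AddCommGroup M] [Module ℂ M] (A : SuperAction FV M)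
    (μ : ℂ) : Prop where
  isModule : A.IsModule
  smooth : FV.IsSmooth A
  ne_zero : μ ≠ 0
  level : FV.HasLevel A (μ ^ 2)

namespace FV.IsSmoothOfLevelSq

open IsFermion

variable {M : Type*} [AddCommGroup M] [Module ℂ M] {A : SuperAction FV M} {μ : ℂ}

/-- The operators `μ⁻¹ ψ_r`. -/
noncomputable def fermion (_ : FV.IsSmoothOfLevelSq A μ) (a : ℤ) : Module.End ℂ M :=
  μ⁻¹ • A.act (basis (.psi a))

theorem act_psi (h : FV.IsSmoothOfLevelSq A μ) (a : ℤ) (x : M) :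
    A.act (basis (.psi a)) x = μ • h.fermion a x := by
  rw [fermion, LinearMap.smul_apply, smul_inv_smul₀ h.ne_zero]

theorem act_bracketGen (h : FV.IsSmoothOfLevelSq A μ) (g g' : FVGen) (v : M) :
    A.act (bracketGen g g') v = A.act (basis g) (A.act (basis g') v)
      - koszul g.parity g'.parity • A.act (basis g') (A.act (basis g) v) := by
  rw [← h.isModule.act_bracket (basis_mem_part g) (basis_mem_part g')]
  exact congrArg (fun y => A.act y v) (bracket_basis g g').symm

theorem isFermion (h : FV.IsSmoothOfLevelSq A μ) : IsFermion h.fermion where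
  anticomm j k x := by
    have h1 := h.act_bracketGen (.psi j) (.psi k) x
    simp only [bracketGen, map_smul, LinearMap.smul_apply, h.level x, koszul, FVGen.parity,
      and_self, if_true, neg_smul, one_smul, sub_neg_eq_add] at h1
    simp only [fermion, LinearMap.smul_apply, map_smul]
    rw [smul_smul, smul_smul, ← smul_add, ← h1, smul_smul, smul_smul]
    congr 1
    have := h.ne_zero
    field_simp
  smooth x := by
    obtain ⟨n, hn⟩ := h.smooth x
    -- The bound in `FV.IsSmooth` is strict, the one in `IsFermion` is not.
    refine ⟨n + 1, fun a ha => ?_⟩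
    rw [fermion, LinearMap.smul_apply, (hn a (by push_cast at ha; omega)).2, smul_zero]

theorem act_L_fermion (h : FV.IsSmoothOfLevelSq A μ) (m a : ℤ) (x : M) :
    A.act (basis (.L m)) (h.fermion a x) = h.fermion a (A.act (basis (.L m)) x)
      + (-((a : ℂ) + 1 / 2) - (m : ℂ) / 2) • h.fermion (m + a) x := by
  have h1 := h.act_bracketGen (.L m) (.psi a) x
  simp only [bracketGen, map_smul, LinearMap.smul_apply, koszul, FVGen.parity,
    zero_ne_one, false_and, if_false, one_smul] at h1
  simp only [fermion, LinearMap.smul_apply, map_smul]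
  rw [eq_add_of_sub_eq' h1.symm]
  module

theorem act_c_fermion (h : FV.IsSmoothOfLevelSq A μ) (a : ℤ) (x : M) :
    A.act (basis .c) (h.fermion a x) = h.fermion a (A.act (basis .c) x) := by
  have h1 := h.act_bracketGen .c (.psi a) x
  simp only [bracketGen, map_zero, LinearMap.zero_apply, koszul, FVGen.parity,
    zero_ne_one, false_and, if_false, one_smul] at h1
  simp only [fermion, LinearMap.smul_apply, map_smul]
  rw [sub_eq_zero.1 h1.symm]

/-- The space of vacuum vectors. -/
noncomputable abbrev vacuum (h : FV.IsSmoothOfLevelSq A μ) : Submodule ℂ M := vac h.fermion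

/-- The part of the action of a generator of the Virasoro algebra that commutes with all `ψ_r`. -/
noncomputable def cosetOp (h : FV.IsSmoothOfLevelSq A μ) : VirGen → Module.End ℂ M
  | .L m => A.act (basis (.L m)) - h.isFermion.virOp m
  | .c => A.act (basis .c) - (1 / 2 : ℂ) • 1

theorem cosetOp_commute (h : FV.IsSmoothOfLevelSq A μ) (g : VirGen) (a : ℤ) (x : M) :
    h.cosetOp g (h.fermion a x) = h.fermion a (h.cosetOp g x) := by
  rcases g with m | _
  · simp only [cosetOp, LinearMap.sub_apply, h.act_L_fermion, h.isFermion.virOp_psi, map_sub]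
    abel
  · simp only [cosetOp, LinearMap.sub_apply, LinearMap.smul_apply, Module.End.one_apply,
      h.act_c_fermion, map_sub, map_smul]

/-- The action of the generators of the Virasoro algebra on the space of vacuum vectors. -/
noncomputable def vacOp (h : FV.IsSmoothOfLevelSq A μ) (g : VirGen) : Module.End ℂ h.vacuum :=
  (h.cosetOp g).restrict (mem_vac_of_commute (h.cosetOp_commute g))

theorem coe_vacOp (h : FV.IsSmoothOfLevelSq A μ) (g : VirGen) (v : h.vacuum) :
    (h.vacOp g v : M) = h.cosetOp g v := rfl

theorem cosetOp_equiv_tmul (h : FV.IsSmoothOfLevelSq A μ) (g : VirGen) (x : Fock) (v : h.vacuum) :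
    h.cosetOp g (h.isFermion.fockEquiv (x ⊗ₜ v)) = h.isFermion.fockEquiv (x ⊗ₜ h.vacOp g v) :=
  h.isFermion.commute_fockEquiv (h.cosetOp_commute g) _

theorem act_L_equiv (h : FV.IsSmoothOfLevelSq A μ) (m : ℤ) (x : Fock) (v : h.vacuum) :
    A.act (basis (.L m)) (h.isFermion.fockEquiv (x ⊗ₜ v))
      = h.isFermion.fockEquiv (Fock.vir m x ⊗ₜ v + x ⊗ₜ h.vacOp (.L m) v) := by
  rw [map_add, ← cosetOp_equiv_tmul, ← LinearMap.rTensor_tmul, ← h.isFermion.virOp_fockEquiv]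
  simp [cosetOp]

theorem act_c_equiv (h : FV.IsSmoothOfLevelSq A μ) (x : Fock) (v : h.vacuum) :
    A.act (basis .c) (h.isFermion.fockEquiv (x ⊗ₜ v))
      = h.isFermion.fockEquiv ((1 / 2 : ℂ) • x ⊗ₜ v + x ⊗ₜ h.vacOp .c v) := by
  rw [map_add, ← cosetOp_equiv_tmul, map_smul]
  simp [cosetOp]

theorem act_psi_equiv (h : FV.IsSmoothOfLevelSq A μ) (a : ℤ) (x : Fock) (v : h.vacuum) :
    A.act (basis (.psi a)) (h.isFermion.fockEquiv (x ⊗ₜ v))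
      = h.isFermion.fockEquiv (μ • Fock.psi a x ⊗ₜ v) := by
  rw [h.act_psi, map_smul, ← LinearMap.rTensor_tmul, h.isFermion.fockEquiv_psi]

theorem one_tmul_injective (h : FV.IsSmoothOfLevelSq A μ) :
    Function.Injective fun v : h.vacuum => (1 : Fock) ⊗ₜ[ℂ] v := fun v w hvw => by
  have := congrArg h.isFermion.fockEquiv hvw
  simpa only [fockEquiv_one_tmul, SetLike.coe_eq_coe] using this

/-- Compare the relations of M on 1 ⊗ v with those of L̄ on Fock. L̄_m ⊗ 1 commutes with 1 ⊗
`vacOp`, so the cross terms cancel. The Fock cocycle (m³ - m)/24 is the central term for the 1/2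
subtracted from c. -/
theorem vacOp_bracketGen (h : FV.IsSmoothOfLevelSq A μ) (g g' : VirGen) (v : h.vacuum) :
    Vir.lift h.vacOp (Vir.bracketGen g g') v
      = h.vacOp g (h.vacOp g' v) - h.vacOp g' (h.vacOp g v) := by
  have hc : ∀ (m : ℤ) (v : h.vacuum),
      h.vacOp (.L m) (h.vacOp .c v) = h.vacOp .c (h.vacOp (.L m) v) := fun m v => by
    apply h.one_tmul_injective
    have h1 := h.act_bracketGen (.L m) .c (h.isFermion.fockEquiv (1 ⊗ₜ v))
    simp only [bracketGen, map_zero, LinearMap.zero_apply, koszul, FVGen.parity,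
      zero_ne_one, false_and, if_false, one_smul, act_L_equiv, act_c_equiv, map_add, map_smul] at h1
    simp only [← map_smul, ← map_add, ← map_sub] at h1
    have h2 := h.isFermion.fockEquiv.map_eq_zero_iff.1 h1.symm
    rw [← sub_eq_zero, ← h2]
    module
  rcases g with m | _ <;> rcases g' with n | _
  · apply h.one_tmul_injective
    have h1 := h.act_bracketGen (.L m) (.L n) (h.isFermion.fockEquiv (1 ⊗ₜ v))
    simp only [bracketGen, map_add, map_smul, LinearMap.add_apply, LinearMap.smul_apply, koszul,
      FVGen.parity, zero_ne_one, false_and, if_false, one_smul, act_L_equiv, act_c_equiv] at h1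
    simp only [← map_smul, ← map_add, ← map_sub] at h1
    have h2 := h.isFermion.fockEquiv.injective h1
    have h3 := congrArg (fun x : Fock => x ⊗ₜ[ℂ] v) (Fock.vir_comm_apply m n 1)
    simp only [TensorProduct.sub_tmul, TensorProduct.add_tmul, ← TensorProduct.smul_tmul',
      Fock.cocycle_formula] at h3
    simp only [Vir.bracketGen, map_add, map_smul, Vir.lift_basis, LinearMap.add_apply,
      LinearMap.smul_apply, TensorProduct.tmul_add, TensorProduct.tmul_sub, TensorProduct.tmul_smul]
    split_ifs at h2 h3 ⊢ <;> linear_combination (norm := module) h2 + h3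
  · rw [hc, sub_self]
    simp [Vir.bracketGen]
  · rw [hc, sub_self]
    simp [Vir.bracketGen]
  · rw [sub_self]
    simp [Vir.bracketGen]

/-! ### Parity of the Fock decomposition and of the coset operators -/

theorem fermion_mem_part (h : FV.IsSmoothOfLevelSq A μ) (k : ℤ) {a : ZMod 2} {v : M}
    (hv : v ∈ A.part a) : h.fermion k v ∈ A.part (1 + a) :=
  Submodule.smul_mem _ _ (h.isModule.act_mem (basis_mem_part (.psi k)) hv)

theorem rho_mem_part (h : FV.IsSmoothOfLevelSq A μ) {a b : ZMod 2} {x : Fock}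
    (hx : x ∈ Fock.action.part a) {v : M} (hv : v ∈ A.part b) :
    h.isFermion.rho x v ∈ A.part (a + b) := by
  have hc : ∀ (m : ℕ →₀ ℂ) {d : ZMod 2} {w : M}, w ∈ A.part d →
      creation h.fermion m w ∈ A.part (1 + d) := fun m d w hw => by
    rw [creation, Finsupp.linearCombination_apply, Finsupp.sum, LinearMap.sum_apply]
    exact Submodule.sum_mem _ fun n _ => Submodule.smul_mem _ _ (h.fermion_mem_part _ hw)
  refine CliffordAlgebra.evenOdd_induction (0 : QuadraticForm ℂ (ℕ →₀ ℂ)) a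
    (motive := fun x _ => h.isFermion.rho x v ∈ A.part (a + b)) ?_ ?_ ?_ x hx
  · intro x hx
    fin_cases a
    · change x ∈ _ ^ 0 at hx
      rw [pow_zero, Submodule.mem_one] at hx
      obtain ⟨r, rfl⟩ := hx
      have : h.isFermion.rho (algebraMap ℂ Fock r) v = r • v := by
        rw [AlgHom.commutes]
        rfl
      refine this ▸ Submodule.smul_mem _ _ ?_
      exact (zero_add b).symm ▸ hv
    · change x ∈ _ ^ 1 at hx
      rw [pow_one] at hx
      obtain ⟨m, rfl⟩ := hx
      have := h.isFermion.rho_ι_mul m 1 v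
      rw [mul_one, map_one] at this
      exact this ▸ hc m hv
  · intro x y _ _ hx hy
    rw [map_add]
    exact add_mem hx hy
  · intro m₁ m₂ x _ hx
    have h1 := (h.isFermion.rho_ι_mul m₁ (ExteriorAlgebra.ι ℂ m₂ * x) v).trans
      (congrArg _ (h.isFermion.rho_ι_mul m₂ x v))
    rw [mul_assoc]
    refine h1 ▸ ?_
    have h2 := hc m₁ (hc m₂ hx)
    rwa [← add_assoc, show (1 + 1 : ZMod 2) = 0 by decide, zero_add] at h2

theorem vacOp_mem_part (h : FV.IsSmoothOfLevelSq A μ) (g : VirGen) {a : ZMod 2} {v : h.vacuum}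
    (hv : (v : M) ∈ A.part a) : (h.vacOp g v : M) ∈ A.part a := by
  have he : ∀ g : FVGen, g.parity = 0 → A.act (basis g) v ∈ A.part a := fun g hg => by
    simpa only [hg, zero_add] using h.isModule.act_mem (basis_mem_part g) hv
  rw [coe_vacOp]
  rcases g with m | _
  · refine sub_mem (he _ rfl) ?_
    rw [← h.isFermion.fockEquiv_one_tmul v, h.isFermion.virOp_fockEquiv, LinearMap.rTensor_tmul,
      h.isFermion.fockEquiv_tmul, ← zero_add a]
    refine h.rho_mem_part (Fock.vir_mem_evenOdd m ?_) hv
    exact SetLike.GradedOne.one_mem (A := CliffordAlgebra.evenOdd (0 : QuadraticForm ℂ (ℕ →₀ ℂ)))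
  · exact sub_mem (he _ rfl) (Submodule.smul_mem _ _ hv)

/-! ### Submodules generated from the vacuum space, and simplicity -/

/-- The submodule of `M` corresponding to `Fock ⊗ U`. -/
noncomputable def generated (h : FV.IsSmoothOfLevelSq A μ) (U : Submodule ℂ h.vacuum) :
    Submodule ℂ M :=
  (Submodule.map₂ (TensorProduct.mk ℂ Fock h.vacuum) ⊤ U).map h.isFermion.fockEquiv.toLinearMap

theorem mem_generated (h : FV.IsSmoothOfLevelSq A μ) {U : Submodule ℂ h.vacuum} (x : Fock)
    {v : h.vacuum} (hv : v ∈ U) : h.isFermion.fockEquiv (x ⊗ₜ v) ∈ h.generated U :=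
  Submodule.mem_map_of_mem (Submodule.apply_mem_map₂ _ trivial hv)

theorem generated_le (h : FV.IsSmoothOfLevelSq A μ) {U : Submodule ℂ h.vacuum} {W : Submodule ℂ M}
    (hW : ∀ (x : Fock), ∀ v ∈ U, h.isFermion.fockEquiv (x ⊗ₜ v) ∈ W) : h.generated U ≤ W := by
  rw [generated, Submodule.map_le_iff_le_comap, Submodule.map₂_le]
  exact fun x _ v hv => hW x v hv

theorem act_mem_generated (h : FV.IsSmoothOfLevelSq A μ) {U : Submodule ℂ h.vacuum}
    (hU : ∀ g, ∀ v ∈ U, h.vacOp g v ∈ U) (y : FV) :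
    ∀ w ∈ h.generated U, A.act y w ∈ h.generated U := by
  have hg : ∀ g : FVGen, h.generated U ≤ (h.generated U).comap (A.act (basis g)) := by
    refine fun g => h.generated_le fun x v hv => ?_
    rw [Submodule.mem_comap]
    rcases g with m | k | _ | _
    · rw [h.act_L_equiv, map_add]
      exact add_mem (h.mem_generated _ hv) (h.mem_generated _ (hU _ v hv))
    · rw [h.act_psi_equiv, map_smul]
      exact Submodule.smul_mem _ _ (h.mem_generated _ hv)
    · rw [h.act_c_equiv, map_add, map_smul]
      exact add_mem (Submodule.smul_mem _ _ (h.mem_generated _ hv)) (h.mem_generated _ (hU _ v hv))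
    · rw [h.level]
      exact Submodule.smul_mem _ _ (h.mem_generated _ hv)
  intro w hw
  have hy : y ∈ Submodule.span ℂ (Set.range basis) := span_basis ▸ trivial
  induction hy using Submodule.span_induction with
  | mem y hy =>
    obtain ⟨g, rfl⟩ := hy
    exact hg g hw
  | zero => simp
  | add y z _ _ hy hz =>
    rw [map_add]
    exact add_mem hy hz
  | smul r y _ hy =>
    rw [map_smul]
    exact Submodule.smul_mem _ _ hy

theorem generated_graded (h : FV.IsSmoothOfLevelSq A μ) {U : Submodule ℂ h.vacuum} {q : ZMod 2}
    (hU : ∀ v ∈ U, (v : M) ∈ A.part q) :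
    h.generated U = (h.generated U ⊓ A.part 0) ⊔ (h.generated U ⊓ A.part 1) := by
  refine le_antisymm (h.generated_le fun x v hv => ?_) (sup_le inf_le_left inf_le_left)
  have hx : x ∈ Fock.action.part 0 ⊔ Fock.action.part 1 :=
    Fock.action.isCompl.sup_eq_top ▸ trivial
  have key : ∀ b : ZMod 2, ∀ y ∈ Fock.action.part b, h.isFermion.fockEquiv (y ⊗ₜ v) ∈
      (h.generated U ⊓ A.part 0) ⊔ (h.generated U ⊓ A.part 1) := fun b y hy => by
    have h1 : h.isFermion.fockEquiv (y ⊗ₜ v) ∈ h.generated U ⊓ A.part (b + q) :=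
      ⟨h.mem_generated y hv, h.rho_mem_part hy (hU v hv)⟩
    have h2 : ∀ d : ZMod 2, d = 0 ∨ d = 1 := by decide
    rcases h2 (b + q) with h3 | h3 <;> rw [h3] at h1
    · exact Submodule.mem_sup_left h1
    · exact Submodule.mem_sup_right h1
  obtain ⟨y, hy, z, hz, rfl⟩ := Submodule.mem_sup.1 hx
  rw [TensorProduct.add_tmul, map_add]
  exact add_mem (key 0 y hy) (key 1 z hz)

/-- Applying the vacuum expectation to the first factor sends Fock ⊗ U into U and 1 ⊗ v to v, so U
is recovered from the submodule it generates. -/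
theorem eq_top_of_generated (h : FV.IsSmoothOfLevelSq A μ) {U : Submodule ℂ h.vacuum}
    (hU : h.generated U = ⊤) : U = ⊤ := by
  refine eq_top_iff.2 fun v _ => ?_
  let f : Fock ⊗[ℂ] h.vacuum →ₗ[ℂ] h.vacuum :=
    (TensorProduct.lid ℂ h.vacuum).toLinearMap ∘ₗ (Fock.vev.toLinearMap).rTensor h.vacuum
  have hf : ∀ (x : Fock) (v : h.vacuum), f (x ⊗ₜ v) = Fock.vev x • v := fun x v => by simp [f]
  obtain ⟨t, ht, htv⟩ : h.isFermion.fockEquiv (1 ⊗ₜ v) ∈ h.generated U := hU ▸ trivial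
  obtain rfl : t = 1 ⊗ₜ v := h.isFermion.fockEquiv.injective htv
  have h1 : Submodule.map₂ (TensorProduct.mk ℂ Fock h.vacuum) ⊤ U ≤ U.comap f :=
    Submodule.map₂_le.2 fun x _ v hv => by
      rw [Submodule.mem_comap, TensorProduct.mk_apply, hf]
      exact U.smul_mem _ hv
  have h2 := h1 ht
  rwa [Submodule.mem_comap, hf, map_one, one_smul] at h2

theorem eq_bot_of_generated (h : FV.IsSmoothOfLevelSq A μ) {U : Submodule ℂ h.vacuum}
    (hU : h.generated U = ⊥) : U = ⊥ := by
  refine eq_bot_iff.2 fun v hv => ?_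
  have h1 := h.mem_generated 1 hv
  rwa [hU, Submodule.mem_bot, fockEquiv_one_tmul, Submodule.coe_eq_zero] at h1

/-- Simplicity tests graded submodules only; the condition that U lie in one parity makes the
generated submodule graded. -/
theorem eq_bot_or_eq_top (h : FV.IsSmoothOfLevelSq A μ) (hA : A.IsSimple)
    {U : Submodule ℂ h.vacuum} (hU : ∀ g, ∀ v ∈ U, h.vacOp g v ∈ U) {q : ZMod 2}
    (hq : ∀ v ∈ U, (v : M) ∈ A.part q) : U = ⊥ ∨ U = ⊤ :=
  (hA.2 _ (h.act_mem_generated hU) (h.generated_graded hq)).imp h.eq_bot_of_generated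
    h.eq_top_of_generated

/-- The even vacuum vectors are stable under the Virasoro operators, so they are everything or zero.
In the second case the even component of a vacuum vector, again a vacuum vector because the ψ_r are
odd, vanishes. -/
theorem exists_vacuum_le_part (h : FV.IsSmoothOfLevelSq A μ) (hA : A.IsSimple) :
    ∃ q : ZMod 2, h.vacuum ≤ A.part q := by
  rcases h.eq_bot_or_eq_top hA (U := (A.part 0).comap h.vacuum.subtype) (q := 0)
    (fun g v hv => h.vacOp_mem_part g hv) (fun v hv => hv) with h0 | h0
  · refine ⟨1, fun v hv => ?_⟩
    have hv' : v ∈ A.part 0 ⊔ A.part 1 := A.isCompl.sup_eq_top ▸ trivial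
    obtain ⟨x, hx, y, hy, rfl⟩ := Submodule.mem_sup.1 hv'
    have hxv : x ∈ h.vacuum := mem_vac.2 fun n hn => by
      have h1 := mem_vac.1 hv n hn
      rw [map_add] at h1
      refine Submodule.disjoint_def.1 A.isCompl.disjoint _ ?_ (h.fermion_mem_part n hx)
      rw [eq_neg_of_add_eq_zero_left h1]
      exact Submodule.neg_mem _ (h.fermion_mem_part n hy)
    have h2 : (⟨x, hxv⟩ : h.vacuum) ∈ (A.part 0).comap h.vacuum.subtype := hx
    rw [h0, Submodule.mem_bot, Submodule.mk_eq_zero] at h2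
    rwa [h2, zero_add]
  · refine ⟨0, fun v hv => ?_⟩
    have h2 : (⟨v, hv⟩ : h.vacuum) ∈ (A.part 0).comap h.vacuum.subtype := h0 ▸ trivial
    exact h2

/-! ### The vacuum space as a simple smooth Virasoro module -/

/-- The action of the Virasoro algebra on the space of vacuum vectors. -/
@[reducible] noncomputable def lieRingModuleVacuum (h : FV.IsSmoothOfLevelSq A μ) :
    LieRingModule Vir h.vacuum := Vir.lieRingModuleOfGen h.vacOp h.vacOp_bracketGen

theorem lieModuleVacuum (h : FV.IsSmoothOfLevelSq A μ) :
    letI := h.lieRingModuleVacuum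
    LieModule ℂ Vir h.vacuum := Vir.lieModuleOfGen h.vacOp h.vacOp_bracketGen

theorem basis_lie (h : FV.IsSmoothOfLevelSq A μ) (g : VirGen) (v : h.vacuum) :
    letI := h.lieRingModuleVacuum
    ⁅Vir.basis g, v⁆ = h.vacOp g v := LinearMap.congr_fun (Vir.lift_basis h.vacOp g) v

theorem isSmooth_vacuum (h : FV.IsSmoothOfLevelSq A μ) :
    letI := h.lieRingModuleVacuum
    Vir.IsSmooth h.vacuum := by
  intro v
  obtain ⟨n, hn⟩ := h.smooth v
  refine ⟨n, fun i hi => ?_⟩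
  rw [h.basis_lie, ← Submodule.coe_eq_zero, coe_vacOp, cosetOp, LinearMap.sub_apply, (hn i hi).1]
  -- On vacuum vectors the correction L̄_i ⊗ 1 vanishes for i ≥ -1, so the bound for `M` serves
  -- unchanged.
  rw [← h.isFermion.fockEquiv_one_tmul v, h.isFermion.virOp_fockEquiv, LinearMap.rTensor_tmul,
    Fock.vir_one (by omega), TensorProduct.zero_tmul, map_zero, sub_zero]

theorem isIrreducible_vacuum (h : FV.IsSmoothOfLevelSq A μ) (hA : A.IsSimple) :
    letI := h.lieRingModuleVacuum
    LieModule.IsIrreducible ℂ Vir h.vacuum := by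
  let := h.lieRingModuleVacuum
  obtain ⟨q, hq⟩ := h.exists_vacuum_le_part hA
  have : Nontrivial h.vacuum := by
    by_contra hn
    rw [not_nontrivial_iff_subsingleton] at hn
    have := hA.1
    have : Nontrivial (Fock ⊗[ℂ] h.vacuum) := h.isFermion.fockEquiv.toEquiv.nontrivial
    exact false_of_nontrivial_of_subsingleton (Fock ⊗[ℂ] h.vacuum)
  refine LieModule.IsIrreducible.mk fun N hN => ?_
  -- The parity condition is automatic, as the whole vacuum space lies in one parity.
  have h1 := h.eq_bot_or_eq_top hA (U := N.toSubmodule)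
    (fun g v hv => h.basis_lie g v ▸ N.lie_mem hv) (fun v _ => hq v.2)
  simp only [LieSubmodule.toSubmodule_eq_bot, LieSubmodule.toSubmodule_eq_top] at h1
  exact h1.resolve_left hN

end FV.IsSmoothOfLevelSq

/-! ### Inverses of even bijections and the tensor action on pure tensors -/

namespace SuperAction

variable {𝔤 : Type*} [AddCommGroup 𝔤] [Module ℂ 𝔤]
variable {M : Type*} [AddCommGroup M] [Module ℂ M] {N : Type*} [AddCommGroup N] [Module ℂ N]

/-- A linear bijection mapping even to even and odd to odd vectors has an even inverse. -/
theorem symm_mem_part (A : SuperAction 𝔤 M) (B : SuperAction 𝔤 N) (e : N ≃ₗ[ℂ] M)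
    (he : ∀ a, ∀ w ∈ B.part a, e w ∈ A.part a) (a : ZMod 2) (v : M) (hv : v ∈ A.part a) :
    e.symm v ∈ B.part a := by
  obtain ⟨w, rfl⟩ := e.surjective v
  rw [LinearEquiv.symm_apply_apply]
  have hw : w ∈ B.part 0 ⊔ B.part 1 := B.isCompl.sup_eq_top ▸ trivial
  obtain ⟨x, hx, y, hy, rfl⟩ := Submodule.mem_sup.1 hw
  have hx' := he 0 x hx
  have hy' := he 1 y hy
  rw [map_add] at hv
  have ha : ∀ a : ZMod 2, a = 0 ∨ a = 1 := by decide
  rcases ha a with rfl | rfl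
  · have : e y = 0 := Submodule.disjoint_def.1 A.isCompl.disjoint _
      ((Submodule.add_mem_iff_right _ hx').1 hv) hy'
    rwa [e.map_eq_zero_iff.1 this, add_zero]
  · have : e x = 0 := Submodule.disjoint_def.1 A.isCompl.disjoint _ hx'
      ((Submodule.add_mem_iff_left _ hy').1 hv)
    rwa [e.map_eq_zero_iff.1 this, zero_add]

variable [LieSuperalgebra 𝔤]

theorem tensor_act_even (A : SuperAction 𝔤 M) (B : SuperAction 𝔤 N) {x : 𝔤}
    (hx : x ∈ LieSuperalgebra.part 0) (v : M) (w : N) :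
    (A.tensor B).act x (v ⊗ₜ w) = A.act x v ⊗ₜ w + v ⊗ₜ B.act x w := by
  simp [tensor, Submodule.projection_apply_of_mem_left _ hx,
    Submodule.projection_apply_of_mem_right _ hx]

theorem tensor_act_odd (A : SuperAction 𝔤 M) (B : SuperAction 𝔤 N) {x : 𝔤}
    (hx : x ∈ LieSuperalgebra.part 1) (v : M) (w : N) :
    (A.tensor B).act x (v ⊗ₜ w) = A.act x v ⊗ₜ w + A.parityOp v ⊗ₜ B.act x w := by
  simp [tensor, Submodule.projection_apply_of_mem_left _ hx,
    Submodule.projection_apply_of_mem_right _ hx]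

end SuperAction

/-! ### The Fock decomposition as an even isomorphism of modules -/

namespace FV.IsSmoothOfLevelSq

open IsFermion

variable {M : Type*} [AddCommGroup M] [Module ℂ M] {A : SuperAction FV M} {μ : ℂ}

theorem inflate_act_basis (h : FV.IsSmoothOfLevelSq A μ) (q : ZMod 2) (g : FVGen) (v : h.vacuum) :
    letI := h.lieRingModuleVacuum
    haveI := h.lieModuleVacuum
    (inflate h.vacuum q).act (basis g) v = match g with
      | .L m => h.vacOp (.L m) v
      | .c => h.vacOp .c v
      | _ => 0 := by
  let := h.lieRingModuleVacuum
  have := h.lieModuleVacuum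
  change ⁅toVir (basis g), v⁆ = _
  rcases g with m | k | _ | _ <;> simp only [toVir, lift_basis]
  · exact h.basis_lie _ v
  · exact zero_lie v
  · exact h.basis_lie _ v
  · exact zero_lie v

theorem equiv_tensor_act (h : FV.IsSmoothOfLevelSq A μ) (q : ZMod 2) (y : FV)
    (t : Fock ⊗[ℂ] h.vacuum) :
    letI := h.lieRingModuleVacuum
    haveI := h.lieModuleVacuum
    h.isFermion.fockEquiv (((twist Fock.action μ).tensor (inflate h.vacuum q)).act y t)
      = A.act y (h.isFermion.fockEquiv t) := by
  let := h.lieRingModuleVacuum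
  have := h.lieModuleVacuum
  have hy : y ∈ Submodule.span ℂ (Set.range basis) := span_basis ▸ trivial
  induction hy using Submodule.span_induction with
  | zero => simp
  | add y z _ _ hy hz => simp only [map_add, LinearMap.add_apply, hy, hz]
  | smul r y _ hy => simp only [map_smul, LinearMap.smul_apply, hy]
  | mem y hy =>
    obtain ⟨g, rfl⟩ := hy
    induction t using TensorProduct.induction_on with
    | zero => simp
    | add t t' ht ht' => simp only [map_add, ht, ht']
    | tmul x v =>
      rcases g with m | k | _ | _
      · rw [SuperAction.tensor_act_even _ _ (basis_mem_part (.L m)), h.inflate_act_basis,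
          h.act_L_equiv]
        simp [twist, sigma, Fock.action]
      -- The term carrying the parity sign vanishes, since ψ acts by zero on the inflated factor.
      · rw [SuperAction.tensor_act_odd _ _ (basis_mem_part (.psi k)), h.inflate_act_basis,
          h.act_psi_equiv]
        simp [twist, sigma, Fock.action, TensorProduct.smul_tmul']
      · rw [SuperAction.tensor_act_even _ _ (basis_mem_part .c), h.inflate_act_basis,
          h.act_c_equiv]
        simp [twist, sigma, Fock.action, TensorProduct.smul_tmul']
      · rw [SuperAction.tensor_act_even _ _ (basis_mem_part .z), h.inflate_act_basis,
          h.level]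
        simp [twist, sigma, Fock.action, ← TensorProduct.smul_tmul']

theorem equiv_mem_part (h : FV.IsSmoothOfLevelSq A μ) {q : ZMod 2} (hq : h.vacuum ≤ A.part q) :
    letI := h.lieRingModuleVacuum
    haveI := h.lieModuleVacuum
    ∀ a, ∀ t ∈ ((twist Fock.action μ).tensor (inflate h.vacuum q)).part a,
      h.isFermion.fockEquiv t ∈ A.part a := by
  let := h.lieRingModuleVacuum
  have := h.lieModuleVacuum
  intro a
  have key : ∀ b d : ZMod 2, b + d = a → Submodule.map₂ (TensorProduct.mk ℂ Fock h.vacuum)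
      ((twist Fock.action μ).part b) ((inflate h.vacuum q).part d)
        ≤ (A.part a).comap h.isFermion.fockEquiv.toLinearMap := by
    intro b d hbd
    refine Submodule.map₂_le.2 fun x hx v hv => ?_
    change v ∈ (if d = q then (⊤ : Submodule ℂ h.vacuum) else ⊥) at hv
    change h.isFermion.fockEquiv (x ⊗ₜ v) ∈ A.part a
    split_ifs at hv with hd
    · subst hd hbd
      exact h.rho_mem_part hx (hq v.2)
    · rw [(Submodule.mem_bot ℂ).1 hv, TensorProduct.tmul_zero, map_zero]
      exact Submodule.zero_mem _
  have h2 : ∀ a : ZMod 2, 1 + (a + 1) = a := by decide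
  exact fun t ht => sup_le (key 0 a (zero_add a)) (key 1 (a + 1) (h2 a)) ht

end FV.IsSmoothOfLevelSq

theorem theorem4p4 {M : Type u} [AddCommGroup M] [Module ℂ M] (A : SuperAction FV M)
    (hmod : A.IsModule) (hsimple : A.IsSimple) (hsmooth : FV.IsSmooth A)
    (ℓ : ℂ) (hℓ : ℓ ≠ 0) (hlevel : FV.HasLevel A ℓ) :
    ∃ μ : ℂ, μ ^ 2 = ℓ ∧ (FV.twist Fock.action μ).IsModule ∧
      ∃ (V : Type u) (_ : AddCommGroup V) (_ : Module ℂ V) (_ : LieRingModule Vir V)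
        (_ : LieModule ℂ Vir V) (p : ZMod 2),
        LieModule.IsIrreducible ℂ Vir V ∧ Vir.IsSmooth V ∧
          Nonempty (A.Iso ((FV.twist Fock.action μ).tensor (FV.inflate V p))) := by
  -- Either square root will do; nothing later depends on the choice.
  obtain ⟨μ, rfl⟩ := IsAlgClosed.exists_pow_nat_eq ℓ (n := 2) two_pos
  have h : FV.IsSmoothOfLevelSq A μ := ⟨hmod, hsmooth, (pow_ne_zero_iff two_ne_zero).1 hℓ, hlevel⟩
  obtain ⟨q, hq⟩ := h.exists_vacuum_le_part hsimple
  let := h.lieRingModuleVacuum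
  have := h.lieModuleVacuum
  refine ⟨μ, rfl, Fock.isModule_twist_action μ, h.vacuum, inferInstance, inferInstance,
    h.lieRingModuleVacuum, h.lieModuleVacuum, q, h.isIrreducible_vacuum hsimple,
    h.isSmooth_vacuum, ⟨⟨h.isFermion.fockEquiv.symm, ?_, fun y v => ?_⟩⟩⟩
  · exact SuperAction.symm_mem_part _ _ _ (h.equiv_mem_part hq)
  · rw [LinearEquiv.symm_apply_eq, h.equiv_tensor_act, LinearEquiv.apply_symm_apply]
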